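/- **Theorem.** Let $\tau$ be the Archimedean tessellation of the Euclidean plane of one of the types $(4.8^2)$, $(3.6.3.6)$, $(3.12^2)$, $(4.6.12)$, $(3.4.6.4)$, $(3^2.4.3.4)$, scaled and placed so that its shortest translational symmetries are represented by $e_1=(1,0)$ and $e_2$, where $e_2=(0,1)$ for $(4.8^2)$ and $(3^2.4.3.4)$ and $e_2=(1/2,\sqrt3/2)$ for the other four types. Let $\tau^*$ be the associated regular tessellation with vertex set $\{o+\lambda e_1+\mu e_2:\lambda,\mu\in\mathbb Z\}$, where the origin $o$ is any vertex of $\tau$; it is the tessellation $\{4,4\}$ by unit squares if $e_2=(0,1)$ and $\{3,6\}$ by unit equilateral triangles otherwise. For a tessellation $\sigma$ let $\mathrm{Aut}(\sigma)$ be the group of isometries of the plane preserving $\sigma$; a flag of $\sigma$ is an incident triple (vertex, edge, face). For a group $G\le\mathrm{Aut}(\sigma)$ generated by two linearly independent translations, the flags of the toroidal map $\sigma/G$ are the $G$-orbits of flags of $\sigma$, and $\mathrm{Aut}(\sigma/G)$ is the group $N_{\mathrm{Aut}(\sigma)}(G)/G$ acting on them. The map $\sigma/G$ is *regular* if $\mathrm{Aut}(\sigma/G)$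 is transitive on its flags, and *almost regular* if it has as many flag orbits under $\mathrm{Aut}(\sigma/G)$ as $\sigma$ has under $\mathrm{Aut}(\sigma)$. Let $u,v$ be linearly independent vectors such that the translations by $u$ and $v$ preserve $\tau$, and write $\tau_{u,v}=\tau/\langle u,v\rangle$. Then the translations by $u$ and $v$ also preserve $\tau^*$, so that $\tau^*_{u,v}=\tau^*/\langle u,v\rangle$ is defined, and $$\tau_{u,v}\ \text{is almost regular}\iff \tau^*_{u,v}\ \text{is regular}.$$ Moreover, the number of flag orbits of $\tau$, and hence of every almost regular map $\tau_{u,v}$, is $3$ for $(4.8^2)$, $2$ for $(3.6.3.6)$, $3$ for $(3.12^2)$, $6$ for $(4.6.12)$, $4$ for $(3.4.6.4)$ and $5$ for $(3^2.4.3.4)$. -/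

import Mathlib

noncomputable section

/-! ### Tessellations of the Euclidean plane

The Euclidean plane is `ℂ` with its usual metric. -/

/-- A regular polygon with `n` corners in the plane, given by its centre and one of its corners. -/
structure RegularPolygon where
  n : ℕ
  center : ℂ
  corner : ℂ

namespace RegularPolygon

/-- The `k`-th corner: `corner` turned about `center` by the angle `2πk/n`. -/
def cornerAt (P : RegularPolygon) (k : ℕ) : ℂ :=
  P.center + (P.corner - P.center) *
    Complex.exp (2 * (Real.pi : ℂ) * Complex.I * ((k : ℂ) / (P.n : ℂ)))

/-- The set of all corners. -/
def corners (P : RegularPolygon) : Set ℂ := Set.range P.cornerAt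

/-- The two endpoints of the `k`-th side. -/
def side (P : RegularPolygon) (k : ℕ) : Set ℂ := {P.cornerAt k, P.cornerAt (k + 1)}

/-- The polygon moved by the vector `z`. -/
def shift (P : RegularPolygon) (z : ℂ) : RegularPolygon :=
  ⟨P.n, P.center + z, P.corner + z⟩

end RegularPolygon

/-- The vertices, edges and faces of a tessellation of the plane by convex polygons.
An edge is recorded by the set of its two endpoints, a face by the set of its corners
(the edge or the face itself is the convex hull of this set). -/
structure Tessellation where
  vertices : Set ℂ
  edges : Set (Set ℂ)
  faces : Set (Set ℂ)

/-- The lattice `{a + b σ : a, b ∈ ℤ}`, that is, all integer combinations of the basis vectors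
`e₁ = 1` and `e₂ = σ`. -/
def planeLattice (σ : ℂ) : Set ℂ := {z | ∃ a b : ℤ, z = (a : ℂ) + (b : ℂ) * σ}

/-- The tessellation whose tiles are all the translates of the polygons in `tiles`
by the vectors of the lattice `ℤ + ℤ σ`. -/
def Tessellation.periodic (σ : ℂ) (tiles : Set RegularPolygon) : Tessellation where
  vertices := {x | ∃ P ∈ tiles, ∃ z ∈ planeLattice σ, x ∈ (P.shift z).corners}
  edges := {e | ∃ P ∈ tiles, ∃ z ∈ planeLattice σ, ∃ k : ℕ, e = (P.shift z).side k}
  faces := {F | ∃ P ∈ tiles, ∃ z ∈ planeLattice σ, F = (P.shift z).corners}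

/-! ### The Archimedean tessellations in question -/

/-- The six types `(4.8²)`, `(3.6.3.6)`, `(3.12²)`, `(4.6.12)`, `(3.4.6.4)`, `(3².4.3.4)`. -/
inductive ArchType where
  | t4_8_8
  | t3_6_3_6
  | t3_12_12
  | t4_6_12
  | t3_4_6_4
  | t3_3_4_3_4

namespace ArchType

/-- `ω = (1 + i√3)/2`. -/
def omega : ℂ := ⟨1 / 2, √3 / 2⟩

/-- The second basis vector: `e₂ = i = (0, 1)` for `(4.8²)` and `(3².4.3.4)`, and
`e₂ = ω = (1/2, √3/2)` for the other four types. The first one is `e₁ = 1 = (1, 0)`. -/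
def sigma : ArchType → ℂ
  | t4_8_8 => Complex.I
  | t3_3_4_3_4 => Complex.I
  | t3_6_3_6 => omega
  | t3_12_12 => omega
  | t4_6_12 => omega
  | t3_4_6_4 => omega

/-- A chosen vertex, lying on one of the tiles around the origin. With `s` the edge length it is
`(1 + i s)/2` for `(4.8²)` (`s = √2 - 1`) and `(3.12²)` (`s = 2 - √3`), it is
`(1 - s + i s)/2` for `(4.6.12)` (`s = (3 - √3)/6`) and `(3.4.6.4)` (`s = (√3 - 1)/2`),
`1/2` for `(3.6.3.6)` (`s = 1/2`) and `((√3 - 1)/2) exp(iπ/6)` for `(3².4.3.4)`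
(`s = (√6 - √2)/2`). -/
def baseVertex : ArchType → ℂ
  | t4_8_8 => ⟨1 / 2, (√2 - 1) / 2⟩
  | t3_6_3_6 => 1 / 2
  | t3_12_12 => ⟨1 / 2, (2 - √3) / 2⟩
  | t4_6_12 => ⟨(3 + √3) / 12, (3 - √3) / 12⟩
  | t3_4_6_4 => ⟨(3 - √3) / 4, (√3 - 1) / 4⟩
  | t3_3_4_3_4 => ⟨(3 - √3) / 4, (√3 - 1) / 4⟩

/-- One tile from every class of tiles under the lattice `ℤ e₁ + ℤ e₂`, each listed as
`⟨number of corners, centre, a corner⟩`. -/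
def tiles : ArchType → Set RegularPolygon
  | t4_8_8 =>
      let p := baseVertex t4_8_8
      {⟨8, 0, p⟩, ⟨4, (1 + Complex.I) / 2, p⟩}
  | t3_6_3_6 =>
      let p := baseVertex t3_6_3_6
      {⟨6, 0, p⟩, ⟨3, (1 + omega) / 3, p⟩, ⟨3, 2 * (1 + omega) / 3, 1 + omega - p⟩}
  | t3_12_12 =>
      let p := baseVertex t3_12_12
      {⟨12, 0, p⟩, ⟨3, (1 + omega) / 3, p⟩, ⟨3, 2 * (1 + omega) / 3, 1 + omega - p⟩}
  | t4_6_12 =>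
      let p := baseVertex t4_6_12
      {⟨12, 0, p⟩, ⟨6, (1 + omega) / 3, p⟩, ⟨6, 2 * (1 + omega) / 3, 1 + omega - p⟩,
        ⟨4, 1 / 2, p⟩, ⟨4, omega / 2, omega * p⟩, ⟨4, omega ^ 2 / 2, omega ^ 2 * p⟩}
  | t3_4_6_4 =>
      let p := baseVertex t3_4_6_4
      {⟨6, 0, p⟩, ⟨3, (1 + omega) / 3, p⟩, ⟨3, 2 * (1 + omega) / 3, 1 + omega - p⟩,
        ⟨4, 1 / 2, p⟩, ⟨4, omega / 2, omega * p⟩, ⟨4, omega ^ 2 / 2, omega ^ 2 * p⟩}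
  | t3_3_4_3_4 =>
      let p := baseVertex t3_3_4_3_4
      let i := Complex.I
      {⟨4, 0, p⟩, ⟨4, (1 + i) / 2, p⟩,
        ⟨3, (2 + i * p) / 3, p⟩, ⟨3, (1 - i * p) / 3, p⟩,
        ⟨3, i * (2 + i * p) / 3, i * p⟩, ⟨3, i * (1 - i * p) / 3, i * p⟩}

/-- The Archimedean tessellation `τ` of the given type, scaled and turned so that `(e₁, e₂)` is its
basis. -/
def tess (t : ArchType) : Tessellation := Tessellation.periodic t.sigma t.tiles

/-- The tiles, up to translation by the lattice `ℤ e₁ + ℤ e₂`, of the regular tessellation `τ*`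
associated with `τ` when the vertex `o` of `τ` is taken as the origin. Its vertex set is `o + ℤ e₁ + ℤ e₂`; it is the tessellation `{4,4}` by unit squares if
`e₂ = i` and the tessellation `{3,6}` by unit triangles if `e₂ = ω`. -/
def assocTiles (o : ℂ) : ArchType → Set RegularPolygon
  | t4_8_8 => {⟨4, o + (1 + Complex.I) / 2, o⟩}
  | t3_3_4_3_4 => {⟨4, o + (1 + Complex.I) / 2, o⟩}
  | _ => {⟨3, o + (1 + omega) / 3, o⟩, ⟨3, o + 2 * (1 + omega) / 3, o + 1⟩}

/-- The associated tessellation `τ*` with origin `o`. -/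
def assoc (t : ArchType) (o : ℂ) : Tessellation := Tessellation.periodic t.sigma (assocTiles o t)

/-- The number of flag orbits attached to the type. -/
def orbitNumber : ArchType → ℕ
  | t4_8_8 => 3
  | t3_6_3_6 => 2
  | t3_12_12 => 3
  | t4_6_12 => 6
  | t3_4_6_4 => 4
  | t3_3_4_3_4 => 5

end ArchType

/-! ### Symmetries and flags of a tessellation -/

namespace Tessellation

/-- The symmetry group `Aut(τ)`: all isometries of the plane that preserve the tessellation. -/
def Aut (τ : Tessellation) : Subgroup (ℂ ≃ᵢ ℂ) where
  carrier := {f | (∀ x, f x ∈ τ.vertices ↔ x ∈ τ.vertices) ∧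
    (∀ e, f '' e ∈ τ.edges ↔ e ∈ τ.edges) ∧ (∀ F, f '' F ∈ τ.faces ↔ F ∈ τ.faces)}
  one_mem' := by
    refine ⟨fun x => Iff.rfl, fun e => ?_, fun F => ?_⟩ <;> simp [IsometryEquiv.coe_one]
  mul_mem' := by
    rintro f g ⟨hf1, hf2, hf3⟩ ⟨hg1, hg2, hg3⟩
    refine ⟨fun x => ?_, fun e => ?_, fun F => ?_⟩
    · rw [IsometryEquiv.mul_apply, hf1, hg1]
    · rw [IsometryEquiv.coe_mul, Set.image_comp, hf2, hg2]
    · rw [IsometryEquiv.coe_mul, Set.image_comp, hf3, hg3]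
  inv_mem' := by
    rintro f ⟨hf1, hf2, hf3⟩
    have key : ∀ s : Set ℂ, f '' ((f⁻¹ : ℂ ≃ᵢ ℂ) '' s) = s := fun s => by
      rw [← Set.image_comp, ← IsometryEquiv.coe_mul, mul_inv_cancel, IsometryEquiv.coe_one,
        Set.image_id]
    refine ⟨fun x => ?_, fun e => ?_, fun F => ?_⟩
    · rw [← hf1, IsometryEquiv.apply_inv_self]
    · rw [← hf2, key]
    · rw [← hf3, key]

/-- The translation of the plane by the vector `u`. -/
def trans (u : ℂ) : ℂ ≃ᵢ ℂ := IsometryEquiv.addLeft u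

/-- `T_τ`: the vectors of all translations that preserve `τ`. -/
def translations (τ : Tessellation) : Set ℂ := {u | trans u ∈ τ.Aut}

/-- The group `⟨u, v⟩` generated by two translations. -/
def transGroup (u v : ℂ) : Subgroup (ℂ ≃ᵢ ℂ) := Subgroup.closure {trans u, trans v}

/-- A flag: an incident triple of a vertex, an edge and a face. -/
@[ext]
structure Flag (τ : Tessellation) where
  vertex : ℂ
  edge : Set ℂ
  face : Set ℂ
  vertex_mem : vertex ∈ τ.vertices
  edge_mem : edge ∈ τ.edges
  face_mem : face ∈ τ.faces
  vertex_edge : vertex ∈ edge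
  edge_face : edge ⊆ face

/-- The symmetries of `τ` act on its flags. -/
instance (τ : Tessellation) : MulAction τ.Aut τ.Flag where
  smul f Φ :=
    { vertex := f.1 Φ.vertex
      edge := f.1 '' Φ.edge
      face := f.1 '' Φ.face
      vertex_mem := (f.2.1 _).2 Φ.vertex_mem
      edge_mem := (f.2.2.1 _).2 Φ.edge_mem
      face_mem := (f.2.2.2 _).2 Φ.face_mem
      vertex_edge := Set.mem_image_of_mem _ Φ.vertex_edge
      edge_face := Set.image_mono Φ.edge_face }
  one_smul Φ := by
    apply Flag.ext
    · rfl
    · exact Set.image_id Φ.edge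
    · exact Set.image_id Φ.face
  mul_smul f g Φ := by
    apply Flag.ext
    · rfl
    · exact Set.image_comp f.1 g.1 Φ.edge
    · exact Set.image_comp f.1 g.1 Φ.face

/-! ### Quotient maps `τ/G`

In what follows `G` is meant to be a group of translations preserving `τ`. -/

/-- `Sym(τ/G)`: the symmetries of `τ` that normalize `G`. -/
def Sym (τ : Tessellation) (G : Subgroup (ℂ ≃ᵢ ℂ)) : Subgroup (ℂ ≃ᵢ ℂ) :=
  τ.Aut ⊓ Subgroup.normalizer (G : Set (ℂ ≃ᵢ ℂ))

/-- `Sym(τ/G)` acts on the flags of `τ`. -/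
instance (τ : Tessellation) (G : Subgroup (ℂ ≃ᵢ ℂ)) : MulAction (τ.Sym G) τ.Flag :=
  MulAction.compHom τ.Flag (Subgroup.inclusion (inf_le_left : τ.Sym G ≤ τ.Aut))

/-- The group `G`, regarded as a subgroup of `Sym(τ/G)`. -/
def deck (τ : Tessellation) (G : Subgroup (ℂ ≃ᵢ ℂ)) : Subgroup (τ.Sym G) := G.subgroupOf (τ.Sym G)

instance (τ : Tessellation) (G : Subgroup (ℂ ≃ᵢ ℂ)) : (τ.deck G).Normal :=
  ⟨fun _ hn g => (Subgroup.mem_normalizer_iff.1 g.2.2 _).1 hn⟩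

/-- The flags of the map `τ/G`: the orbits of flags of `τ` under `G`. -/
abbrev MapFlag (τ : Tessellation) (G : Subgroup (ℂ ≃ᵢ ℂ)) : Type :=
  MulAction.orbitRel.Quotient (τ.deck G) τ.Flag

/-- The automorphism group `Aut(τ/G) = Sym(τ/G)/G`. -/
abbrev MapAut (τ : Tessellation) (G : Subgroup (ℂ ≃ᵢ ℂ)) : Type := τ.Sym G ⧸ τ.deck G

/-- The action of `Aut(τ/G)` on the flags of `τ/G` induced by the action of `Sym(τ/G)` on the flags
of `τ`: the class of `γ` sends the `G`-orbit of a flag `Φ` to the `G`-orbit of `γ Φ`. -/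
instance (τ : Tessellation) (G : Subgroup (ℂ ≃ᵢ ℂ)) : MulAction (τ.MapAut G) (τ.MapFlag G) where
  smul := Quotient.map₂ (fun (γ : τ.Sym G) (Φ : τ.Flag) => γ • Φ) (by
    rintro γ γ' hγ Φ Φ' ⟨⟨g, hg⟩, rfl⟩
    have hγ' : γ⁻¹ * γ' ∈ τ.deck G := QuotientGroup.leftRel_apply.1 hγ
    refine ⟨⟨γ * g * γ'⁻¹, ?_⟩, ?_⟩
    · have h1 : γ * (g * (γ⁻¹ * γ')⁻¹) * γ⁻¹ ∈ τ.deck G :=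
        (inferInstance : (τ.deck G).Normal).conj_mem _
          ((τ.deck G).mul_mem hg ((τ.deck G).inv_mem hγ')) γ
      have h2 : γ * (g * (γ⁻¹ * γ')⁻¹) * γ⁻¹ = γ * g * γ'⁻¹ := by group
      rwa [h2] at h1
    · change (γ * g * γ'⁻¹) • γ' • Φ' = γ • g • Φ'
      rw [smul_smul, smul_smul]
      congr 1
      group)
  one_smul := by
    rintro ⟨Φ⟩
    exact congrArg (Quotient.mk _) (one_smul (τ.Sym G) Φ)
  mul_smul := by
    rintro ⟨γ⟩ ⟨γ'⟩ ⟨Φ⟩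
    exact congrArg (Quotient.mk _) (mul_smul γ γ' Φ)

/-- The number of flag orbits of the planar tessellation `τ` under its symmetry group. -/
def numFlagOrbits (τ : Tessellation) : ℕ∞ :=
  ENat.card (MulAction.orbitRel.Quotient τ.Aut τ.Flag)

/-- The number of flag orbits of the map `τ/G` under its automorphism group. -/
def mapNumFlagOrbits (τ : Tessellation) (G : Subgroup (ℂ ≃ᵢ ℂ)) : ℕ∞ :=
  ENat.card (MulAction.orbitRel.Quotient (τ.MapAut G) (τ.MapFlag G))

/-- The map `τ/G` is regular: its automorphism group is transitive on its flags. -/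
def IsRegularMap (τ : Tessellation) (G : Subgroup (ℂ ≃ᵢ ℂ)) : Prop :=
  MulAction.IsPretransitive (τ.MapAut G) (τ.MapFlag G)

/-- The map `τ/G` is almost regular: it has the same number of flag orbits as `τ`. -/
def IsAlmostRegularMap (τ : Tessellation) (G : Subgroup (ℂ ≃ᵢ ℂ)) : Prop :=
  τ.mapNumFlagOrbits G = τ.numFlagOrbits

end Tessellation

end

/-! Each flag orbit of τ/G lies in one flag orbit of τ, which gives a surjection between the two
sets of orbits (`mapOrbitToOrbit`). If τ has finitely many flag orbits, almost regularity says
exactly that this surjection is injective. Only the identity fixes a flag (`eq_one_of_smul_flag`),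
so injectivity forces every symmetry of τ to normalize G; conversely, if all symmetries normalize G,
the orbits coincide (`isAlmostRegularMap_iff`). The tessellation τ* has a single flag orbit, so for
it regularity is the same condition (`isRegularMap_iff`). Both sides of the equivalence thus say
that a symmetry group normalizes ⟨u, v⟩.

Translations centralize ⟨u, v⟩, so only linear parts of symmetries matter
(`aut_le_normalizer_of_linear_parts`), and τ and τ* have the same ones. A symmetry with linear part
z ↦ az or z ↦ a z̄ conjugates the translation by 1 into the translation by a, so a is a lattice
vector of length one, hence a power of σ (`exists_eq_pow`). Conversely, one rotation with factor σ
and one reflection or glide reflection produce all these linear parts (`exists_mem_aut`).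

For the orbit counts, a flag is encoded as a polygon with a chosen corner and a direction
(`exists_flag_eq`), so that symmetries act on finite labels up to lattice translation. Tables of
this action, verified by algebra with √2, √3 and i, bound the number of orbits from above by a
finite check (`FlagTable.Covers`). The lower bound compares face sizes and linear parts
(`not_equivalent_of_separated`); one pair of flags in (4.6.12) and one in (3².4.3.4) need separate
arguments. -/

noncomputable section

/-! ### Isometries of the plane -/

/-- The identity for `false`, complex conjugation for `true`. -/
def conjIf (s : Bool) : ℂ →+* ℂ := cond s (starRingEnd ℂ) (RingHom.id ℂ)

/-- The sign of the orientation: `1` for `false`, `-1` for `true`. -/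
def orient (s : Bool) : ℤ := cond s (-1) 1

@[simp] theorem conjIf_false (z : ℂ) : conjIf false z = z := rfl

@[simp] theorem conjIf_true (z : ℂ) : conjIf true z = (starRingEnd ℂ) z := rfl

@[simp] theorem orient_false : orient false = 1 := rfl

@[simp] theorem orient_true : orient true = -1 := rfl

theorem orient_xor (s s' : Bool) : orient (xor s s') = orient s * orient s' := by
  cases s <;> cases s' <;> rfl

theorem conjIf_injective (s : Bool) : Function.Injective (conjIf s) := (conjIf s).injective

/-- Conjugation inverts numbers on the unit circle. Applied to roots of unity, it makes an isometry
act on corner numbers through the sign `orient s`. -/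
theorem conjIf_of_norm_eq_one (s : Bool) {z : ℂ} (hz : ‖z‖ = 1) :
    conjIf s z = z ^ orient s := by
  cases s
  · simp
  · simp [Complex.inv_eq_conj hz]

/-- By Mazur–Ulam, f minus its value at 0 is real linear, and a linear isometry of ℂ is a rotation,
possibly preceded by conjugation. -/
theorem IsometryEquiv.exists_conjIf (f : ℂ ≃ᵢ ℂ) :
    ∃ (a b : ℂ) (s : Bool), ‖a‖ = 1 ∧ ∀ z, f z = a * conjIf s z + b := by
  obtain ⟨a, ha⟩ := linear_isometry_complex f.toRealLinearIsometryEquiv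
  have key : ∀ z, f z = f.toRealLinearIsometryEquiv z + f 0 := fun z => by
    rw [IsometryEquiv.toRealLinearIsometryEquiv_apply]; ring
  rcases ha with ha | ha
  · refine ⟨a, f 0, false, Circle.norm_coe a, fun z => ?_⟩
    rw [key, ha, rotation_apply, conjIf_false]
  · refine ⟨a, f 0, true, Circle.norm_coe a, fun z => ?_⟩
    rw [key, ha]
    simp [rotation_apply]

theorem trans_apply (u z : ℂ) : Tessellation.trans u z = u + z := rfl

theorem trans_add (u v : ℂ) :
    Tessellation.trans (u + v) = Tessellation.trans u * Tessellation.trans v :=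
  IsometryEquiv.ext fun z => by simp [IsometryEquiv.mul_apply, trans_apply, add_assoc]

theorem trans_zero : Tessellation.trans 0 = 1 :=
  IsometryEquiv.ext fun z => by simp [trans_apply]

theorem trans_neg (u : ℂ) : Tessellation.trans (-u) = (Tessellation.trans u)⁻¹ :=
  eq_inv_of_mul_eq_one_left (by rw [← trans_add, neg_add_cancel, trans_zero])

theorem IsometryEquiv.exists_of_norm_eq_one {a : ℂ} (ha : ‖a‖ = 1) (b : ℂ) (s : Bool) :
    ∃ f : ℂ ≃ᵢ ℂ, ∀ z, f z = a * conjIf s z + b := by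
  refine ⟨Tessellation.trans b *
    (rotation ⟨a, mem_sphere_zero_iff_norm.2 ha⟩).toIsometryEquiv *
    cond s Complex.conjLIE.toIsometryEquiv 1, fun z => ?_⟩
  cases s <;> exact add_comm b _

/-! ### Rooted regular polygons -/

namespace RegularPolygon

/-- The first `n`-th root of unity. -/
def root (n : ℕ) : ℂ := Complex.exp (2 * (Real.pi : ℂ) * Complex.I / (n : ℂ))

theorem root_isPrimitiveRoot {n : ℕ} (hn : n ≠ 0) : IsPrimitiveRoot (root n) n :=
  Complex.isPrimitiveRoot_exp n hn

theorem norm_root (n : ℕ) : ‖root n‖ = 1 := by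
  rw [root, show (2 * (Real.pi : ℂ) * Complex.I / (n : ℂ)) =
    ((2 * Real.pi / n : ℝ) : ℂ) * Complex.I by push_cast; ring]
  exact Complex.norm_exp_ofReal_mul_I _

theorem root_ne_zero (n : ℕ) : root n ≠ 0 := Complex.exp_ne_zero _

/-- The vector from the centre to the chosen corner. -/
def radius (P : RegularPolygon) : ℂ := P.corner - P.center

/-- The same polygon with its `k`-th corner as the chosen one. -/
def turn (P : RegularPolygon) (k : ℤ) : RegularPolygon :=
  ⟨P.n, P.center, P.center + P.radius * root P.n ^ k⟩

/-- The image of a polygon under an isometry. -/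
def map (f : ℂ ≃ᵢ ℂ) (P : RegularPolygon) : RegularPolygon := ⟨P.n, f P.center, f P.corner⟩

/-- The side that leaves the chosen corner in the positive (`false`) or negative (`true`)
direction. -/
def edge (P : RegularPolygon) (s : Bool) : Set ℂ := {P.corner, (P.turn (orient s)).corner}

/-- A polygon with at least three sides and positive radius. -/
def IsProper (P : RegularPolygon) : Prop := 3 ≤ P.n ∧ P.radius ≠ 0

/-- The squared side length. -/
def sideSq (P : RegularPolygon) : ℂ :=
  P.radius * (starRingEnd ℂ) P.radius * ((root P.n - 1) * ((starRingEnd ℂ) (root P.n) - 1))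

variable (P : RegularPolygon) (k l : ℤ) (s : Bool) (z : ℂ)

@[simp] theorem turn_n : (P.turn k).n = P.n := rfl
@[simp] theorem turn_center : (P.turn k).center = P.center := rfl
theorem turn_corner : (P.turn k).corner = P.center + P.radius * root P.n ^ k := rfl
@[simp] theorem turn_radius : (P.turn k).radius = P.radius * root P.n ^ k := by
  simp [radius, turn]
@[simp] theorem shift_n : (P.shift z).n = P.n := rfl
@[simp] theorem shift_center : (P.shift z).center = P.center + z := rfl
@[simp] theorem shift_corner : (P.shift z).corner = P.corner + z := rfl
@[simp] theorem shift_radius : (P.shift z).radius = P.radius := by simp [radius]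

theorem center_add_radius : P.center + P.radius = P.corner := by simp [radius]

theorem ext_radius {P Q : RegularPolygon} (hn : P.n = Q.n) (hc : P.center = Q.center)
    (hr : P.radius = Q.radius) : P = Q := by
  obtain ⟨n, c, p⟩ := P
  obtain ⟨n', c', p'⟩ := Q
  simp only [radius] at *
  subst hn hc
  simpa using hr

theorem turn_turn : (P.turn k).turn l = P.turn (k + l) :=
  ext_radius rfl rfl (by simp [zpow_add₀ (root_ne_zero _), mul_assoc])

theorem turn_zero : P.turn 0 = P := ext_radius rfl rfl (by simp)

theorem shift_zero : P.shift 0 = P := ext_radius rfl (by simp) (by simp)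

theorem shift_shift (z w : ℂ) : (P.shift z).shift w = P.shift (z + w) :=
  ext_radius rfl (by simp [add_assoc]) (by simp)

theorem turn_shift : (P.shift z).turn k = (P.turn k).shift z :=
  ext_radius rfl (by simp) (by simp)

theorem turn_emod (hn : P.n ≠ 0) : P.turn (k % P.n) = P.turn k := by
  refine ext_radius rfl rfl ?_
  simp only [turn_radius]
  conv_rhs => rw [← Int.emod_add_mul_ediv k P.n]
  simp [zpow_add₀ (root_ne_zero _), zpow_mul, (root_isPrimitiveRoot hn).pow_eq_one]

theorem cornerAt_eq (k : ℕ) : P.cornerAt k = (P.turn k).corner := by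
  rw [turn_corner, cornerAt, zpow_natCast, root, ← Complex.exp_nat_mul, radius]
  congr 3
  ring

theorem corners_eq_range (hn : P.n ≠ 0) :
    P.corners = Set.range fun k : ℤ => (P.turn k).corner := by
  apply Set.eq_of_subset_of_subset
  · rintro _ ⟨k, rfl⟩
    exact ⟨k, (P.cornerAt_eq k).symm⟩
  · rintro _ ⟨k, rfl⟩
    have h : 0 ≤ k % P.n := Int.emod_nonneg _ (by exact_mod_cast hn)
    refine ⟨(k % P.n).toNat, ?_⟩
    rw [cornerAt_eq, Int.toNat_of_nonneg h, turn_emod P k hn]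

theorem corners_turn (hn : P.n ≠ 0) : (P.turn k).corners = P.corners := by
  rw [corners_eq_range P hn, corners_eq_range (P.turn k) hn]
  apply Set.eq_of_subset_of_subset
  · rintro _ ⟨l, rfl⟩
    exact ⟨k + l, by simp only [turn_turn]⟩
  · rintro _ ⟨l, rfl⟩
    exact ⟨l - k, by simp only [turn_turn, add_sub_cancel]⟩

theorem side_eq (k : ℕ) : P.side k = (P.turn k).edge false := by
  rw [side, edge, turn_turn, cornerAt_eq, cornerAt_eq]
  norm_num

variable {P}

theorem IsProper.ne_zero (h : P.IsProper) : P.n ≠ 0 := by have := h.1; omega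

theorem IsProper.turn (h : P.IsProper) : (P.turn k).IsProper :=
  ⟨h.1, by simpa using ⟨h.2, fun h' => absurd h' (zpow_ne_zero k (root_ne_zero _))⟩⟩

theorem IsProper.shift (h : P.IsProper) : (P.shift z).IsProper := ⟨h.1, by simpa using h.2⟩

theorem sideSq_turn : (P.turn k).sideSq = P.sideSq := by
  have h : root P.n ^ k * (starRingEnd ℂ) (root P.n ^ k) = 1 := by
    rw [Complex.mul_conj', norm_zpow, norm_root]
    simp
  simp only [sideSq, turn_radius, turn_n, map_mul]
  linear_combination P.radius * (starRingEnd ℂ) P.radius *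
    ((root P.n - 1) * ((starRingEnd ℂ) (root P.n) - 1)) * h

theorem sideSq_shift : (P.shift z).sideSq = P.sideSq := by simp [sideSq]

/-! ### Recovering a polygon from its set of corners. -/

theorem cornerAt_injOn (h : P.IsProper) :
    Set.InjOn P.cornerAt (Finset.range P.n : Finset ℕ) := by
  intro k hk l hl hkl
  simp only [cornerAt_eq, turn_corner, zpow_natCast, add_right_inj, mul_eq_mul_left_iff, h.2,
    or_false] at hkl
  exact (root_isPrimitiveRoot h.ne_zero).pow_inj (by simpa using hk) (by simpa using hl) hkl

theorem corners_eq_image (h : P.n ≠ 0) :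
    P.corners = ((Finset.range P.n).image P.cornerAt : Finset ℂ) := by
  apply Set.eq_of_subset_of_subset
  · rintro _ ⟨k, rfl⟩
    rw [Finset.mem_coe, Finset.mem_image]
    refine ⟨k % P.n, Finset.mem_range.2 (Nat.mod_lt _ (Nat.pos_of_ne_zero h)), ?_⟩
    rw [cornerAt_eq, cornerAt_eq, ← turn_emod P k h]
    norm_cast
  · intro x hx
    obtain ⟨k, -, rfl⟩ := Finset.mem_image.1 (Finset.mem_coe.1 hx)
    exact ⟨k, rfl⟩

theorem ncard_corners (h : P.IsProper) : P.corners.ncard = P.n := by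
  rw [corners_eq_image h.ne_zero, Set.ncard_coe_finset,
    Finset.card_image_of_injOn (cornerAt_injOn h), Finset.card_range]

/-- The n-th roots of unity sum to zero, so the centre is the mean of the corners and can be read
off from the corner set alone. -/
theorem finsum_corners (h : P.IsProper) : ∑ᶠ x ∈ P.corners, x = P.n * P.center := by
  rw [corners_eq_image h.ne_zero, finsum_mem_coe_finset, Finset.sum_image (cornerAt_injOn h)]
  have := (root_isPrimitiveRoot h.ne_zero).geom_sum_eq_zero (by have := h.1; omega)
  simp [cornerAt_eq, turn_corner, Finset.sum_add_distrib, ← Finset.mul_sum, this]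

theorem eq_of_corners_eq {P Q : RegularPolygon} (hP : P.IsProper) (hQ : Q.IsProper)
    (h : P.corners = Q.corners) : P.n = Q.n ∧ P.center = Q.center := by
  have hn : P.n = Q.n := by rw [← ncard_corners hP, ← ncard_corners hQ, h]
  refine ⟨hn, ?_⟩
  have h2 := finsum_corners hQ
  rw [← h, finsum_corners hP, hn] at h2
  exact mul_left_cancel₀ (by exact_mod_cast hQ.ne_zero) h2

/-- If a primitive n-th root of unity equals its inverse, its square is 1, so n ≤ 2. -/
theorem root_zpow_orient_injective {n : ℕ} (hn : 3 ≤ n) {s s' : Bool}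
    (h : root n ^ orient s = root n ^ orient s') : s = s' := by
  have hr := root_isPrimitiveRoot (n := n) (by omega)
  have key : root n ≠ (root n)⁻¹ := fun h' => by
    have h2 : root n ^ 2 = 1 := by
      rw [sq]; nth_rewrite 2 [h']; exact mul_inv_cancel₀ (root_ne_zero n)
    have := Nat.le_of_dvd (by norm_num) (hr.dvd_of_pow_eq_one 2 h2)
    omega
  cases s <;> cases s' <;> simp at h ⊢
  · exact key h
  · exact key h.symm

/-- A rooted polygon is determined by the flag that it spans. -/
theorem eq_of_flag_eq {P Q : RegularPolygon} (hP : P.IsProper) (hQ : Q.IsProper) {s s' : Bool}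
    (h1 : P.corner = Q.corner) (h2 : P.edge s = Q.edge s') (h3 : P.corners = Q.corners) :
    P = Q ∧ s = s' := by
  obtain ⟨hn, hc⟩ := eq_of_corners_eq hP hQ h3
  obtain rfl : P = Q := ext_radius hn hc (by rw [radius, radius, h1, hc])
  refine ⟨rfl, root_zpow_orient_injective hP.1 (n := P.n) ?_⟩
  have hmem : (P.turn (orient s)).corner ∈ P.edge s' := by rw [← h2, edge]; simp
  -- The neighbouring corner in direction s is either the chosen corner itself, which would make the
  -- root of unity trivial, or the neighbour in direction s'.
  rcases hmem with hmem | hmem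
  · exfalso
    have h4 : root P.n ^ orient s = 1 := by
      rw [turn_corner, ← center_add_radius P] at hmem
      exact mul_left_cancel₀ hP.2 (by simpa using hmem)
    have h5 : root P.n = 1 := by cases s <;> simpa using h4
    exact (root_isPrimitiveRoot hP.ne_zero).ne_one (by have := hP.1; omega) h5
  · rw [Set.mem_singleton_iff, turn_corner, turn_corner] at hmem
    exact mul_left_cancel₀ hP.2 (add_left_cancel hmem)

/-! Images under isometries. -/

theorem map_mul (f g : ℂ ≃ᵢ ℂ) (P : RegularPolygon) : P.map (f * g) = (P.map g).map f := rfl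

theorem map_trans (u : ℂ) (P : RegularPolygon) : P.map (Tessellation.trans u) = P.shift u := by
  simp [map, shift, trans_apply, add_comm]

section Map

variable {f : ℂ ≃ᵢ ℂ} {a b : ℂ} {s : Bool}

theorem map_radius (hf : ∀ z, f z = a * conjIf s z + b) (P : RegularPolygon) :
    (P.map f).radius = a * conjIf s P.radius := by
  simp only [radius, map, hf, map_sub]; ring

theorem map_shift (hf : ∀ z, f z = a * conjIf s z + b) (P : RegularPolygon) (z : ℂ) :
    (P.shift z).map f = (P.map f).shift (a * conjIf s z) :=
  ext_radius rfl (by simp only [shift_center, map, hf, map_add]; ring)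
    (by rw [map_radius hf, shift_radius, shift_radius, map_radius hf])

theorem map_turn (hf : ∀ z, f z = a * conjIf s z + b) (P : RegularPolygon) (k : ℤ) :
    (P.turn k).map f = (P.map f).turn (orient s * k) := by
  refine ext_radius rfl rfl ?_
  rw [map_radius hf, turn_radius, turn_radius, map_radius hf, _root_.map_mul, map_zpow₀,
    conjIf_of_norm_eq_one s (norm_root _), zpow_mul, mul_assoc]
  rfl

theorem IsProper.map (hf : ∀ z, f z = a * conjIf s z + b) (ha : ‖a‖ = 1)
    (h : P.IsProper) : (P.map f).IsProper := by
  refine ⟨h.1, ?_⟩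
  rw [map_radius hf]
  exact mul_ne_zero (norm_ne_zero_iff.1 (by simp [ha]))
    ((map_ne_zero_iff _ (conjIf_injective s)).2 h.2)

theorem image_edge (hf : ∀ z, f z = a * conjIf s z + b) (P : RegularPolygon) (s' : Bool) :
    f '' P.edge s' = (P.map f).edge (xor s s') := by
  rw [edge, edge, Set.image_pair, orient_xor, ← map_turn hf]
  rfl

theorem image_corners (hf : ∀ z, f z = a * conjIf s z + b) (hP : P.n ≠ 0) :
    f '' P.corners = (P.map f).corners := by
  have key : ∀ k, f (P.turn k).corner = ((P.map f).turn (orient s * k)).corner := fun k => by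
    rw [← map_turn hf]; rfl
  have hs : orient s * orient s = 1 := by cases s <;> rfl
  rw [corners_eq_range P hP, corners_eq_range (P.map f) hP]
  apply Set.eq_of_subset_of_subset
  · rintro _ ⟨_, ⟨k, rfl⟩, rfl⟩
    exact ⟨_, (key k).symm⟩
  · rintro _ ⟨k, rfl⟩
    exact ⟨_, ⟨orient s * k, rfl⟩, by simp only [key, ← mul_assoc, hs, one_mul]⟩

end Map

/-- Two corners of a regular polygon at the distance of the side length are adjacent. -/
theorem eq_turn_of_dist {P : RegularPolygon} (hP : P.IsProper) {k : ℤ}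
    (h : ((P.turn k).corner - P.corner) * (starRingEnd ℂ) ((P.turn k).corner - P.corner) =
      P.sideSq) : ∃ s, P.turn k = P.turn (orient s) := by
  set w := root P.n ^ k with hw
  have hr : (starRingEnd ℂ) P.radius ≠ 0 := (map_ne_zero_iff _ (RingHom.injective _)).2 hP.2
  have hz : root P.n * (starRingEnd ℂ) (root P.n) = 1 := by
    rw [Complex.mul_conj', norm_root]; simp
  have hww : w * (starRingEnd ℂ) w = 1 := by
    rw [Complex.mul_conj', hw, norm_zpow, norm_root]; simp
  have h1 : (P.turn k).corner - P.corner = P.radius * (w - 1) := by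
    rw [turn_corner, ← center_add_radius P]; ring
  have h2 : (w - 1) * ((starRingEnd ℂ) w - 1) =
      (root P.n - 1) * ((starRingEnd ℂ) (root P.n) - 1) := by
    rw [h1, sideSq] at h
    apply mul_left_cancel₀ (mul_ne_zero hP.2 hr)
    rw [← h]
    simp only [_root_.map_mul, map_sub, map_one]
    ring
  -- Two points of the unit circle equally far from 1 have the same real part, so they are equal or
  -- conjugate.
  have h3 : (w - root P.n) * (w - (starRingEnd ℂ) (root P.n)) = 0 := by
    linear_combination (1 - w) * hz - w * h2 + (w - 1) * hww
  have hζ : (starRingEnd ℂ) (root P.n) = (root P.n)⁻¹ :=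
    (Complex.inv_eq_conj (norm_root P.n)).symm
  rcases mul_eq_zero.1 h3 with h4 | h4
  · exact ⟨false, ext_radius rfl rfl (by simp [← hw, sub_eq_zero.1 h4])⟩
  · exact ⟨true, ext_radius rfl rfl (by simp [← hw, sub_eq_zero.1 h4, hζ])⟩

end RegularPolygon

/-! ### Flag orbits of quotient maps -/

namespace Tessellation

variable {τ : Tessellation} {G : Subgroup (ℂ ≃ᵢ ℂ)}

/-- A flag orbit of `τ/G` determines a flag orbit of `τ`. -/
def mapOrbitToOrbit (τ : Tessellation) (G : Subgroup (ℂ ≃ᵢ ℂ)) :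
    MulAction.orbitRel.Quotient (τ.MapAut G) (τ.MapFlag G) →
      MulAction.orbitRel.Quotient τ.Aut τ.Flag :=
  Quotient.lift
    (Quotient.lift (fun Φ : τ.Flag => (Quotient.mk _ Φ : MulAction.orbitRel.Quotient τ.Aut τ.Flag))
      (by
        rintro Φ Ψ ⟨⟨g, _⟩, rfl⟩
        exact Quotient.sound ⟨⟨g.1, g.2.1⟩, rfl⟩))
    (by
      rintro ⟨Φ⟩ ⟨Ψ⟩ ⟨⟨γ⟩, h⟩
      obtain ⟨⟨g, _⟩, hg⟩ := Quotient.exact h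
      refine Quotient.sound ⟨⟨(g⁻¹ * γ).1, (g⁻¹ * γ).2.1⟩, ?_⟩
      change (g⁻¹ * γ) • Ψ = Φ
      have hg' : g • Φ = γ • Ψ := hg
      rw [mul_smul, ← hg', inv_smul_smul])

theorem mapOrbitToOrbit_surjective : Function.Surjective (mapOrbitToOrbit τ G) := by
  rintro ⟨Φ⟩
  exact ⟨Quotient.mk _ (Quotient.mk _ Φ), rfl⟩

/-- Under this hypothesis `Sym(τ/G)` is all of `Aut(τ)`, so a symmetry joining two flags also acts
on the quotient map. -/
theorem mapOrbitToOrbit_injective_of_le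
    (h : τ.Aut ≤ Subgroup.normalizer (G : Set (ℂ ≃ᵢ ℂ))) :
    Function.Injective (mapOrbitToOrbit τ G) := by
  rintro ⟨⟨Φ⟩⟩ ⟨⟨Ψ⟩⟩ hΦΨ
  obtain ⟨⟨f, hf⟩, rfl⟩ := Quotient.exact hΦΨ
  exact Quotient.sound ⟨QuotientGroup.mk (⟨f, hf, h hf⟩ : τ.Sym G), rfl⟩

/-- If some flag has trivial stabilizer, then the orbits of `τ/G` and `τ` agree only if all
symmetries of `τ` normalize `G`. -/
theorem le_normalizer_of_injective {Φ : τ.Flag} (hΦ : ∀ f : τ.Aut, f • Φ = Φ → f = 1)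
    (h : Function.Injective (mapOrbitToOrbit τ G)) :
    τ.Aut ≤ Subgroup.normalizer (G : Set (ℂ ≃ᵢ ℂ)) := by
  intro f hf
  have h1 : mapOrbitToOrbit τ G (Quotient.mk _ (Quotient.mk _ ((⟨f, hf⟩ : τ.Aut) • Φ))) =
      mapOrbitToOrbit τ G (Quotient.mk _ (Quotient.mk _ Φ)) := Quotient.sound ⟨⟨f, hf⟩, rfl⟩
  obtain ⟨⟨γ⟩, hγ⟩ := Quotient.exact (h h1)
  obtain ⟨⟨g, _⟩, hg⟩ := Quotient.exact hγ
  have hg' : g • (⟨f, hf⟩ : τ.Aut) • Φ = γ • Φ := hg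
  -- Injectivity puts f Φ and Φ in one orbit of the quotient: g f Φ = γ Φ with g in G and γ in
  -- `Sym(τ/G)`. Then γ⁻¹ g f fixes Φ, so f is the inverse of γ⁻¹ g and normalizes G.
  have h2 := hΦ ((⟨(γ⁻¹ * g).1, (γ⁻¹ * g).2.1⟩ : τ.Aut) * ⟨f, hf⟩) (by
    rw [mul_smul]
    change (γ⁻¹ * g) • (⟨f, hf⟩ : τ.Aut) • Φ = Φ
    rw [mul_smul, hg', inv_smul_smul])
  have h3 : (γ⁻¹ * g).1 * f = 1 := congrArg Subtype.val h2
  rw [← inv_eq_of_mul_eq_one_right h3]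
  exact Subgroup.inv_mem _ (γ⁻¹ * g).2.2

theorem isAlmostRegularMap_iff {n : ℕ} (hn : τ.numFlagOrbits = n) {Φ : τ.Flag}
    (hΦ : ∀ f : τ.Aut, f • Φ = Φ → f = 1) :
    τ.IsAlmostRegularMap G ↔ τ.Aut ≤ Subgroup.normalizer (G : Set (ℂ ≃ᵢ ℂ)) := by
  refine ⟨fun h => le_normalizer_of_injective hΦ ?_, fun h => ?_⟩
  · have h' : τ.mapNumFlagOrbits G = n := h.trans hn
    have hfin : Finite (MulAction.orbitRel.Quotient (τ.MapAut G) (τ.MapFlag G)) :=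
      ENat.card_lt_top.1 (lt_of_eq_of_lt h' (ENat.natCast_lt_top n))
    -- A surjection from a finite set onto a set of the same size is injective; this is where
    -- finiteness of the number of flag orbits is needed.
    refine (mapOrbitToOrbit_surjective.bijective_of_nat_card_le (le_of_eq ?_)).1
    exact congrArg ENat.toNat h
  · exact ENat.card_congr
      (Equiv.ofBijective _ ⟨mapOrbitToOrbit_injective_of_le h, mapOrbitToOrbit_surjective⟩)

/-- When τ has one flag orbit, regular and almost regular mean the same: transitivity gives at most
one orbit, and the flag Φ gives at least one. -/
theorem isRegularMap_iff (hn : τ.numFlagOrbits = 1) {Φ : τ.Flag}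
    (hΦ : ∀ f : τ.Aut, f • Φ = Φ → f = 1) :
    τ.IsRegularMap G ↔ τ.Aut ≤ Subgroup.normalizer (G : Set (ℂ ≃ᵢ ℂ)) := by
  rw [← isAlmostRegularMap_iff (n := 1) (by exact_mod_cast hn) hΦ, IsRegularMap,
    MulAction.pretransitive_iff_subsingleton_quotient, IsAlmostRegularMap, hn, mapNumFlagOrbits]
  have : Nonempty (MulAction.orbitRel.Quotient (τ.MapAut G) (τ.MapFlag G)) :=
    ⟨Quotient.mk _ (Quotient.mk _ Φ)⟩
  rw [← ENat.card_le_one_iff_subsingleton]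
  exact ⟨fun h => le_antisymm h ((ENat.one_le_card_iff_nonempty _).2 this), fun h => h.le⟩

/-- Translations commute, so they even centralize the group. -/
theorem trans_mem_normalizer_transGroup (u v b : ℂ) :
    trans b ∈ Subgroup.normalizer (transGroup u v : Set (ℂ ≃ᵢ ℂ)) := by
  have hc : trans b ∈ Subgroup.centralizer (transGroup u v : Set (ℂ ≃ᵢ ℂ)) := by
    rw [transGroup, Subgroup.centralizer_closure, Subgroup.mem_centralizer_iff]
    rintro g (rfl | rfl) <;> rw [← trans_add, ← trans_add, add_comm]
  exact Subgroup.centralizer_le_normalizer _ hc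

/-- Whether an isometry normalizes a group of translations depends only on its linear part, so a
symmetry of τ may be corrected by a translation into a symmetry of τ'. -/
theorem aut_le_normalizer_of_linear_parts {τ τ' : Tessellation} (u v : ℂ)
    (h : ∀ f ∈ τ.Aut, ∃ b, trans b * f ∈ τ'.Aut)
    (h' : τ'.Aut ≤ Subgroup.normalizer (transGroup u v : Set (ℂ ≃ᵢ ℂ))) :
    τ.Aut ≤ Subgroup.normalizer (transGroup u v : Set (ℂ ≃ᵢ ℂ)) := by
  intro f hf
  obtain ⟨b, hb⟩ := h f hf
  exact (Subgroup.mul_mem_cancel_left _ (trans_mem_normalizer_transGroup u v b)).1 (h' hb)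

end Tessellation

/-! ### Lattices with rotational symmetry -/

theorem add_mem_planeLattice {σ z w : ℂ} (hz : z ∈ planeLattice σ) (hw : w ∈ planeLattice σ) :
    z + w ∈ planeLattice σ := by
  obtain ⟨a, b, rfl⟩ := hz
  obtain ⟨c, d, rfl⟩ := hw
  exact ⟨a + c, b + d, by push_cast; ring⟩

theorem neg_mem_planeLattice {σ z : ℂ} (hz : z ∈ planeLattice σ) : -z ∈ planeLattice σ := by
  obtain ⟨a, b, rfl⟩ := hz
  exact ⟨-a, -b, by push_cast; ring⟩

theorem zero_mem_planeLattice (σ : ℂ) : 0 ∈ planeLattice σ := ⟨0, 0, by simp⟩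

theorem one_mem_planeLattice (σ : ℂ) : 1 ∈ planeLattice σ := ⟨1, 0, by simp⟩

/-- The lattice `ℤ + ℤ σ` is invariant under multiplication by `σ`, an `m`-th root of unity, and
under conjugation, and its vectors of length one are the powers of `σ`. -/
structure IsSymmetricLattice (σ : ℂ) (m : ℕ) : Prop where
  pos : 0 < m
  pow_eq_one : σ ^ m = 1
  ne_one : σ ≠ 1
  mul_self_mem : σ * σ ∈ planeLattice σ
  conj_mem : (starRingEnd ℂ) σ ∈ planeLattice σ
  unit : ∀ a ∈ planeLattice σ, ‖a‖ = 1 → ∃ k : ℕ, a = σ ^ k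

namespace IsSymmetricLattice

variable {σ : ℂ} {m : ℕ} (h : IsSymmetricLattice σ m)
include h

theorem norm_eq_one : ‖σ‖ = 1 := Complex.norm_eq_one_of_pow_eq_one h.pow_eq_one h.pos.ne'

theorem mul_mem {z : ℂ} (hz : z ∈ planeLattice σ) : σ * z ∈ planeLattice σ := by
  obtain ⟨c, d, hcd⟩ := h.mul_self_mem
  obtain ⟨a, b, rfl⟩ := hz
  exact ⟨b * c, a + b * d, by push_cast; linear_combination (b : ℂ) * hcd⟩

theorem conjIf_mem (s : Bool) {z : ℂ} (hz : z ∈ planeLattice σ) :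
    conjIf s z ∈ planeLattice σ := by
  obtain ⟨c, d, hcd⟩ := h.conj_mem
  cases s
  · exact hz
  · obtain ⟨a, b, rfl⟩ := hz
    refine ⟨a + b * c, b * d, ?_⟩
    simp only [conjIf_true, map_add, map_mul, map_intCast, hcd]
    push_cast
    ring

end IsSymmetricLattice

/-! ### Periodic tessellations -/

/-- A finite family of regular polygons with a common side length. -/
structure Motif (N : ℕ) where
  tile : Fin N → RegularPolygon
  side : ℂ
  proper : ∀ j, (tile j).IsProper
  sideSq_eq : ∀ j, (tile j).sideSq = side

namespace Motif

open Tessellation RegularPolygon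

variable {N : ℕ} (D : Motif N) (σ : ℂ)

/-- The tessellation by the translates of the tiles. -/
abbrev tess : Tessellation := Tessellation.periodic σ (Set.range D.tile)

/-- All tiles of the tessellation with all choices of a corner. -/
def rooted : Set RegularPolygon :=
  {P | ∃ j, ∃ k : ℤ, ∃ z ∈ planeLattice σ, P = ((D.tile j).turn k).shift z}

variable {D σ} {P Q R : RegularPolygon} {s s' s'' : Bool}

theorem proper_of_mem (h : P ∈ D.rooted σ) : P.IsProper := by
  obtain ⟨j, k, z, -, rfl⟩ := h
  exact ((D.proper j).turn k).shift z

theorem sideSq_of_mem (h : P ∈ D.rooted σ) : P.sideSq = D.side := by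
  obtain ⟨j, k, z, -, rfl⟩ := h
  rw [sideSq_shift, sideSq_turn, D.sideSq_eq]

theorem tile_mem (j : Fin N) : D.tile j ∈ D.rooted σ :=
  ⟨j, 0, 0, zero_mem_planeLattice σ, by rw [turn_zero, shift_zero]⟩

theorem turn_mem (k : ℤ) (h : P ∈ D.rooted σ) : P.turn k ∈ D.rooted σ := by
  obtain ⟨j, l, z, hz, rfl⟩ := h
  exact ⟨j, l + k, z, hz, by rw [turn_shift, turn_turn]⟩

theorem shift_mem {z : ℂ} (hz : z ∈ planeLattice σ) (h : P ∈ D.rooted σ) :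
    P.shift z ∈ D.rooted σ := by
  obtain ⟨j, l, w, hw, rfl⟩ := h
  exact ⟨j, l, w + z, add_mem_planeLattice hw hz, by rw [shift_shift]⟩

/-! ### Flags as rooted tiles with a direction. -/

theorem mem_vertices {x : ℂ} :
    x ∈ (D.tess σ).vertices ↔ ∃ P ∈ D.rooted σ, x = P.corner := by
  constructor
  · rintro ⟨_, ⟨j, rfl⟩, z, hz, k, rfl⟩
    exact ⟨_, turn_mem k (shift_mem hz (tile_mem j)), cornerAt_eq _ k⟩
  · rintro ⟨_, ⟨j, k, z, hz, rfl⟩, rfl⟩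
    refine ⟨_, ⟨j, rfl⟩, z, hz, ?_⟩
    rw [corners_eq_range _ ((D.proper j).shift z).ne_zero]
    exact ⟨k, by simp only [turn_shift]⟩

theorem mem_faces {F : Set ℂ} :
    F ∈ (D.tess σ).faces ↔ ∃ P ∈ D.rooted σ, F = P.corners := by
  constructor
  · rintro ⟨_, ⟨j, rfl⟩, z, hz, rfl⟩
    exact ⟨_, shift_mem hz (tile_mem j), rfl⟩
  · rintro ⟨_, ⟨j, k, z, hz, rfl⟩, rfl⟩
    exact ⟨_, ⟨j, rfl⟩, z, hz, by
      rw [← turn_shift, corners_turn _ _ ((D.proper j).shift z).ne_zero]⟩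

theorem edge_true (P : RegularPolygon) : P.edge true = (P.turn (-1)).edge false := by
  rw [edge, edge, turn_turn, Set.pair_comm]
  simp [turn_zero]

theorem mem_edges {e : Set ℂ} :
    e ∈ (D.tess σ).edges ↔ ∃ P ∈ D.rooted σ, ∃ s, e = P.edge s := by
  constructor
  · rintro ⟨_, ⟨j, rfl⟩, z, hz, k, rfl⟩
    exact ⟨_, turn_mem k (shift_mem hz (tile_mem j)), false, side_eq _ k⟩
  · have key : ∀ P ∈ D.rooted σ, P.edge false ∈ (D.tess σ).edges := by
      rintro _ ⟨j, k, z, hz, rfl⟩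
      have hn := ((D.proper j).shift z).ne_zero
      refine ⟨_, ⟨j, rfl⟩, z, hz, (k % (D.tile j).n).toNat, ?_⟩
      rw [side_eq, Int.toNat_of_nonneg (Int.emod_nonneg _ (by exact_mod_cast hn)), ← turn_shift]
      congr 1
      exact (turn_emod _ k hn).symm
    rintro ⟨P, hP, s, rfl⟩
    cases s
    · exact key P hP
    · rw [edge_true]
      exact key _ (turn_mem _ hP)

/-- The flag spanned by a rooted tile and a direction. -/
def flag (P : RegularPolygon) (hP : P ∈ D.rooted σ) (s : Bool) : (D.tess σ).Flag where
  vertex := P.corner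
  edge := P.edge s
  face := P.corners
  vertex_mem := mem_vertices.2 ⟨P, hP, rfl⟩
  edge_mem := mem_edges.2 ⟨P, hP, s, rfl⟩
  face_mem := mem_faces.2 ⟨P, hP, rfl⟩
  vertex_edge := Set.mem_insert _ _
  edge_face := by
    rw [corners_eq_range P (proper_of_mem hP).ne_zero]
    rintro x (rfl | rfl)
    · exact ⟨0, by simp only [turn_zero]⟩
    · exact ⟨_, rfl⟩

theorem dist_edge (P : RegularPolygon) (s : Bool) :
    ((P.turn (orient s)).corner - P.corner) *
      (starRingEnd ℂ) ((P.turn (orient s)).corner - P.corner) = P.sideSq := by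
  have h1 : (P.turn (orient s)).corner - P.corner = P.radius * (root P.n ^ orient s - 1) := by
    rw [turn_corner, ← center_add_radius P]; ring
  rw [h1, sideSq]
  cases s
  · simp only [orient_false, zpow_one, _root_.map_mul, map_sub, map_one]; ring
  · simp only [orient_true, zpow_neg, zpow_one, Complex.inv_eq_conj (norm_root P.n), _root_.map_mul,
      map_sub, map_one, Complex.conj_conj]
    ring

/-- Incidence of edge and face is only inclusion of sets of points, and the edge may be listed as a
side of another tile. Since all tiles have the same side length, two corners of the face at that
distance are adjacent, so the edge is a side of this face too. -/
theorem exists_flag_eq (Φ : (D.tess σ).Flag) : ∃ P, ∃ hP : P ∈ D.rooted σ, ∃ s,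
    Φ = flag P hP s := by
  obtain ⟨x, e, F, hx, he, hF, hxe, heF⟩ := Φ
  obtain ⟨P, hP, rfl⟩ := mem_faces.1 hF
  have hn := (proper_of_mem hP).ne_zero
  have key : ∀ x y : ℂ, x ∈ P.corners → y ∈ P.corners →
      (y - x) * (starRingEnd ℂ) (y - x) = D.side →
      ∃ Q ∈ D.rooted σ, ∃ s, x = Q.corner ∧ {x, y} = Q.edge s ∧ P.corners = Q.corners := by
    intro x y hx hy hxy
    rw [corners_eq_range P hn] at hx hy
    obtain ⟨k, rfl⟩ := hx
    obtain ⟨l, rfl⟩ := hy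
    have hl : P.turn l = (P.turn k).turn (l - k) := by rw [turn_turn, add_sub_cancel]
    simp only [hl] at hxy ⊢
    have hk := turn_mem k hP
    rw [← sideSq_of_mem hk] at hxy
    obtain ⟨s, hs⟩ := eq_turn_of_dist (proper_of_mem hk) hxy
    exact ⟨_, hk, s, rfl, by rw [hs]; rfl, (corners_turn P k hn).symm⟩
  have main : ∃ Q ∈ D.rooted σ, ∃ s, x = Q.corner ∧ e = Q.edge s ∧ P.corners = Q.corners := by
    obtain ⟨R, hR, s, rfl⟩ := mem_edges.1 he
    have hd := dist_edge R s
    rw [sideSq_of_mem hR] at hd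
    have h1 := heF (Set.mem_insert _ _)
    have h2 := heF (Set.mem_insert_of_mem _ rfl)
    rcases hxe with rfl | hxe
    · exact key _ _ h1 h2 hd
    · rw [Set.mem_singleton_iff] at hxe
      subst hxe
      rw [edge, Set.pair_comm]
      refine key _ _ h2 h1 ?_
      rw [← hd]
      simp only [map_sub]
      ring
  obtain ⟨Q, hQ, s, h1, h2, h3⟩ := main
  exact ⟨Q, hQ, s, Tessellation.Flag.ext h1 h2 h3⟩

theorem flag_injective {hP : P ∈ D.rooted σ} {hQ : Q ∈ D.rooted σ}
    (h : flag P hP s = flag Q hQ s') : P = Q ∧ s = s' :=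
  eq_of_flag_eq (proper_of_mem hP) (proper_of_mem hQ) (congrArg Tessellation.Flag.vertex h)
    (congrArg Tessellation.Flag.edge h) (congrArg Tessellation.Flag.face h)

/-! Symmetries act on the rooted tiles. -/

section Symmetry

variable {f : ℂ ≃ᵢ ℂ} {a b : ℂ}

/-- The image flag is spanned by some rooted tile, and a flag determines its rooted tile, so that
tile must be the image of P. This replaces the action on sets of points by an action on rooted
polygons. -/
theorem smul_flag (hf : f ∈ (D.tess σ).Aut) (hfab : ∀ z, f z = a * conjIf s z + b)
    (hP : P ∈ D.rooted σ) (s' : Bool) : ∃ hQ : P.map f ∈ D.rooted σ,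
      (⟨f, hf⟩ : (D.tess σ).Aut) • flag P hP s' = flag (P.map f) hQ (xor s s') := by
  -- A second normal form of f supplies ‖a'‖ = 1, which `IsProper.map` needs and `hfab` does not
  -- record.
  obtain ⟨a', b', t, ha, hfab'⟩ := f.exists_conjIf
  obtain ⟨Q, hQ, u, hu⟩ := exists_flag_eq ((⟨f, hf⟩ : (D.tess σ).Aut) • flag P hP s')
  have h1 : f P.corner = Q.corner := congrArg Tessellation.Flag.vertex hu
  have h2 : f '' P.edge s' = Q.edge u := congrArg Tessellation.Flag.edge hu
  have h3 : f '' P.corners = Q.corners := congrArg Tessellation.Flag.face hu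
  rw [image_edge hfab] at h2
  rw [image_corners hfab (proper_of_mem hP).ne_zero] at h3
  obtain ⟨rfl, rfl⟩ := eq_of_flag_eq ((proper_of_mem hP).map hfab' ha) (proper_of_mem hQ) h1 h2 h3
  exact ⟨hQ, hu⟩

theorem map_mem (hf : f ∈ (D.tess σ).Aut) (hP : P ∈ D.rooted σ) : P.map f ∈ D.rooted σ := by
  obtain ⟨a, b, s, -, hfab⟩ := f.exists_conjIf
  exact (smul_flag hf hfab hP false).1

theorem mem_aut (h : ∀ P ∈ D.rooted σ, P.map f ∈ D.rooted σ)
    (h' : ∀ P ∈ D.rooted σ, P.map f⁻¹ ∈ D.rooted σ) : f ∈ (D.tess σ).Aut := by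
  have key : ∀ g : ℂ ≃ᵢ ℂ, (∀ P ∈ D.rooted σ, P.map g ∈ D.rooted σ) →
      (∀ x ∈ (D.tess σ).vertices, g x ∈ (D.tess σ).vertices) ∧
      (∀ e ∈ (D.tess σ).edges, g '' e ∈ (D.tess σ).edges) ∧
      (∀ F ∈ (D.tess σ).faces, g '' F ∈ (D.tess σ).faces) := by
    intro g hg
    obtain ⟨a, b, s, -, hgab⟩ := g.exists_conjIf
    refine ⟨fun x hx => ?_, fun e he => ?_, fun F hF => ?_⟩
    · obtain ⟨P, hP, rfl⟩ := mem_vertices.1 hx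
      exact mem_vertices.2 ⟨_, hg P hP, rfl⟩
    · obtain ⟨P, hP, s, rfl⟩ := mem_edges.1 he
      exact mem_edges.2 ⟨_, hg P hP, _, image_edge hgab P s⟩
    · obtain ⟨P, hP, rfl⟩ := mem_faces.1 hF
      exact mem_faces.2 ⟨_, hg P hP, image_corners hgab (proper_of_mem hP).ne_zero⟩
  have inv : ∀ S : Set ℂ, (f⁻¹ : ℂ ≃ᵢ ℂ) '' (f '' S) = S := fun S => by
    rw [← Set.image_comp, ← IsometryEquiv.coe_mul, inv_mul_cancel, IsometryEquiv.coe_one,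
      Set.image_id]
  obtain ⟨h1, h2, h3⟩ := key f h
  obtain ⟨i1, i2, i3⟩ := key f⁻¹ h'
  refine ⟨fun x => ⟨fun hx => ?_, h1 x⟩, fun e => ⟨fun he => ?_, h2 e⟩,
    fun F => ⟨fun hF => ?_, h3 F⟩⟩
  · simpa using i1 _ hx
  · simpa only [inv] using i2 _ he
  · simpa only [inv] using i3 _ hF

theorem trans_mem_aut {z : ℂ} (hz : z ∈ planeLattice σ) : trans z ∈ (D.tess σ).Aut := by
  refine mem_aut (fun P hP => ?_) (fun P hP => ?_)
  · rw [map_trans]; exact shift_mem hz hP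
  · rw [← trans_neg, map_trans]; exact shift_mem (neg_mem_planeLattice hz) hP

/-- The inverse of f is fᵏ followed by a lattice translation, so it suffices to know where f itself
sends the tiles. -/
theorem mem_aut_of_pow {k : ℕ} {l : ℂ} (hl : l ∈ planeLattice σ) (hk : f ^ (k + 1) = trans l)
    (h : ∀ P ∈ D.rooted σ, P.map f ∈ D.rooted σ) : f ∈ (D.tess σ).Aut := by
  refine mem_aut h fun P hP => ?_
  have h1 : f⁻¹ = trans (-l) * f ^ k := by
    rw [trans_neg, ← hk, pow_succ']; group
  have h2 : ∀ j : ℕ, P.map (f ^ j) ∈ D.rooted σ := by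
    intro j
    induction j with
    | zero => exact hP
    | succ j ih => rw [pow_succ', map_mul]; exact h _ ih
  rw [h1, map_mul, map_trans]
  exact shift_mem (neg_mem_planeLattice hl) (h2 k)

theorem map_mem_of_tiles (hfab : ∀ z, f z = a * conjIf s z + b)
    (hL : ∀ z ∈ planeLattice σ, a * conjIf s z ∈ planeLattice σ)
    (h : ∀ j, (D.tile j).map f ∈ D.rooted σ) : ∀ P ∈ D.rooted σ, P.map f ∈ D.rooted σ := by
  rintro _ ⟨j, k, z, hz, rfl⟩
  rw [map_shift hfab, map_turn hfab]
  exact shift_mem (hL z hz) (turn_mem _ (h j))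

end Symmetry

/-! Equivalence of flags. -/

variable (D σ) in
/-- The flags spanned by two rooted tiles are equivalent under the symmetry group. -/
def Equivalent (P : RegularPolygon) (s : Bool) (Q : RegularPolygon) (s' : Bool) : Prop :=
  ∃ f ∈ (D.tess σ).Aut, ∃ (a b : ℂ) (t : Bool), (∀ z, f z = a * conjIf t z + b) ∧
    P.map f = Q ∧ xor t s = s'

theorem equivalent_iff (hP : P ∈ D.rooted σ) (hQ : Q ∈ D.rooted σ) :
    D.Equivalent σ P s Q s' ↔
      (Quotient.mk _ (flag P hP s) : MulAction.orbitRel.Quotient (D.tess σ).Aut (D.tess σ).Flag) =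
        Quotient.mk _ (flag Q hQ s') := by
  rw [eq_comm]
  constructor
  · rintro ⟨f, hf, a, b, t, hfab, rfl, rfl⟩
    exact Quotient.sound ⟨⟨f, hf⟩, (smul_flag hf hfab hP s).2⟩
  · intro h
    obtain ⟨⟨f, hf⟩, h⟩ := Quotient.exact h
    obtain ⟨a, b, t, -, hfab⟩ := f.exists_conjIf
    obtain ⟨hQ', h'⟩ := smul_flag hf hfab hP s
    have h'' : (⟨f, hf⟩ : (D.tess σ).Aut) • flag P hP s = flag Q hQ s' := h
    rw [h'] at h''
    obtain ⟨h1, h2⟩ := flag_injective h''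
    exact ⟨f, hf, a, b, t, hfab, h1, h2⟩

theorem equivalent_map {f : ℂ ≃ᵢ ℂ} (hf : f ∈ (D.tess σ).Aut) {a b : ℂ} {t : Bool}
    (hfab : ∀ z, f z = a * conjIf t z + b) (P : RegularPolygon) (s : Bool) :
    D.Equivalent σ P s (P.map f) (xor t s) := ⟨f, hf, a, b, t, hfab, rfl, rfl⟩

theorem Equivalent.mem (h : D.Equivalent σ P s Q s') (hP : P ∈ D.rooted σ) :
    Q ∈ D.rooted σ := by
  obtain ⟨f, hf, -, -, -, -, rfl, -⟩ := h
  exact map_mem hf hP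

theorem Equivalent.trans (hP : P ∈ D.rooted σ) (h : D.Equivalent σ P s Q s')
    (h' : D.Equivalent σ Q s' R s'') : D.Equivalent σ P s R s'' := by
  have hQ := h.mem hP
  have hR := h'.mem hQ
  rw [equivalent_iff hP hQ] at h
  rw [equivalent_iff hQ hR] at h'
  rw [equivalent_iff hP hR, h, h']

theorem Equivalent.symm (hP : P ∈ D.rooted σ) (h : D.Equivalent σ P s Q s') :
    D.Equivalent σ Q s' P s := by
  have hQ := h.mem hP
  rw [equivalent_iff hP hQ] at h
  rw [equivalent_iff hQ hP, h]

theorem equivalent_shift {z : ℂ} (hz : z ∈ planeLattice σ) (P : RegularPolygon) (s : Bool) :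
    D.Equivalent σ P s (P.shift z) s := by
  have := equivalent_map (D := D) (trans_mem_aut hz) (a := 1) (b := z) (t := false)
    (fun w => by simp [trans_apply, add_comm]) P s
  rwa [map_trans, Bool.false_xor] at this

/-- Only the identity fixes a flag. -/
theorem eq_one_of_smul_flag {hP : P ∈ D.rooted σ} (f : (D.tess σ).Aut)
    (h : f • flag P hP s = flag P hP s) : f = 1 := by
  obtain ⟨f, hf⟩ := f
  obtain ⟨a, b, t, -, hfab⟩ := f.exists_conjIf
  obtain ⟨hQ, h'⟩ := smul_flag hf hfab hP s
  rw [h'] at h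
  obtain ⟨h1, h2⟩ := flag_injective h
  -- The fixed direction excludes orientation reversal; the fixed radius then gives a = 1, and the
  -- fixed centre b = 0.
  have ht : t = false := by cases t <;> cases s <;> simp at h2 ⊢
  subst ht
  have hr := map_radius hfab P
  rw [h1, conjIf_false] at hr
  have ha : a = 1 := by
    have := (proper_of_mem hP).2
    field_simp at hr
    exact hr.symm
  have hc : f P.center = P.center := congrArg RegularPolygon.center h1
  have hb : b = 0 := by simpa [hfab, ha] using hc
  refine Subtype.ext (IsometryEquiv.ext fun z => ?_)
  simp [hfab, ha, hb]

end Motif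

/-! ### Motifs with the full symmetry of the lattice -/

/-- How a rotation and a reflection permute the rooted tiles of a motif, up to translation, together
with `M` chosen rooted tiles and directions. The rotation takes the first corner of tile `j` to
corner `rotTurn j` of the translate of tile `rotIdx j` by the lattice vector with coordinates
`rotShift j`, and similarly for the reflection. -/
structure FlagTable (N M : ℕ) where
  size : Fin N → ℕ
  rotIdx : Fin N → Fin N
  rotTurn : Fin N → ℕ
  rotShift : Fin N → ℤ × ℤ
  refIdx : Fin N → Fin N
  refTurn : Fin N → ℕ
  refShift : Fin N → ℤ × ℤ
  rep : Fin M → Fin N × ℕ × Bool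

namespace FlagTable

variable {N M : ℕ} (T : FlagTable N M)

/-- The action of the rotation on labels of flags. -/
def rot (x : Fin N × ℤ × Bool) : Fin N × ℤ × Bool :=
  (T.rotIdx x.1, T.rotTurn x.1 + x.2.1, x.2.2)

/-- The action of the reflection on labels of flags. -/
def ref (x : Fin N × ℤ × Bool) : Fin N × ℤ × Bool :=
  (T.refIdx x.1, T.refTurn x.1 - x.2.1, !x.2.2)

/-- Two labels denote the same flag. -/
def Same (x y : Fin N × ℤ × Bool) : Prop :=
  x.1 = y.1 ∧ x.2.1 % T.size x.1 = y.2.1 % T.size x.1 ∧ x.2.2 = y.2.2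

instance (x y : Fin N × ℤ × Bool) : Decidable (T.Same x y) :=
  inferInstanceAs (Decidable (_ ∧ _))

/-- The label of the `i`-th chosen flag. -/
def repLabel (i : Fin M) : Fin N × ℤ × Bool := ((T.rep i).1, (T.rep i).2.1, (T.rep i).2.2)

/-- Every label can be moved to a chosen one. -/
def Covers (m : ℕ) : Prop :=
  ∀ j, ∀ k : Fin (T.size j), ∀ s, ∃ i, ∃ a : Fin m, ∃ b : Bool,
    T.Same (T.rot^[a] (cond b T.ref id (j, (k : ℤ), s))) (T.repLabel i)

instance (m : ℕ) : Decidable (T.Covers m) := inferInstanceAs (Decidable (∀ _, _))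

/-- Two chosen flags differ in the size of the face, or they belong to the same face and no
rotation through a multiple of `2π/m` takes one to the other. -/
def Separated (m : ℕ) (i i' : Fin M) : Prop :=
  T.size (T.rep i).1 ≠ T.size (T.rep i').1 ∨
    ((T.rep i).1 = (T.rep i').1 ∧ (T.rep i).2.2 = (T.rep i').2.2 ∧
      ¬ ((T.size (T.rep i).1 : ℤ) ∣ m * ((T.rep i').2.1 - (T.rep i).2.1)))

instance (m : ℕ) (i i' : Fin M) : Decidable (T.Separated m i i') :=
  inferInstanceAs (Decidable (_ ∨ _))

end FlagTable

/-- A motif whose periodic tessellation admits rotations and reflections with all linear parts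
that preserve the lattice `ℤ + ℤ σ`, and no translations other than those of the lattice. -/
structure SymmetricMotif (σ : ℂ) (m : ℕ) {N M : ℕ} (T : FlagTable N M) extends Motif N where
  nonempty : 0 < N
  lattice : IsSymmetricLattice σ m
  size_eq : ∀ j, (tile j).n = T.size j
  rotPart : ℂ
  rot_size : ∀ j, T.size (T.rotIdx j) = T.size j
  rot_center : ∀ j, σ * (tile j).center + rotPart =
    (tile (T.rotIdx j)).center + ((T.rotShift j).1 + (T.rotShift j).2 * σ)
  rot_radius : ∀ j, σ * (tile j).radius =
    (tile (T.rotIdx j)).radius * RegularPolygon.root (T.size j) ^ T.rotTurn j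
  refPart : ℂ
  refPart_mem : refPart + (starRingEnd ℂ) refPart ∈ planeLattice σ
  ref_size : ∀ j, T.size (T.refIdx j) = T.size j
  ref_center : ∀ j, (starRingEnd ℂ) (tile j).center + refPart =
    (tile (T.refIdx j)).center + ((T.refShift j).1 + (T.refShift j).2 * σ)
  ref_radius : ∀ j, (starRingEnd ℂ) (tile j).radius =
    (tile (T.refIdx j)).radius * RegularPolygon.root (T.size j) ^ T.refTurn j
  mem_of_translation : ∀ u ∈ (toMotif.tess σ).translations, u ∈ planeLattice σ

namespace SymmetricMotif

open Tessellation RegularPolygon Motif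

variable {σ : ℂ} {m N M : ℕ} {T : FlagTable N M} (D : SymmetricMotif σ m T)

theorem translations_eq : (D.toMotif.tess σ).translations = planeLattice σ :=
  Set.eq_of_subset_of_subset D.mem_of_translation fun _ hu => trans_mem_aut hu

theorem rot_tile {f : ℂ ≃ᵢ ℂ} (hf : ∀ z, f z = σ * conjIf false z + D.rotPart) (j : Fin N) :
    ∃ z ∈ planeLattice σ,
      (D.tile j).map f = ((D.tile (T.rotIdx j)).turn (T.rotTurn j)).shift z := by
  refine ⟨_, ⟨(T.rotShift j).1, (T.rotShift j).2, rfl⟩, ext_radius ?_ ?_ ?_⟩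
  · exact (D.size_eq j).trans ((D.rot_size j).symm.trans (D.size_eq _).symm)
  · simpa [RegularPolygon.map, hf] using D.rot_center j
  · rw [map_radius hf, shift_radius, turn_radius, D.size_eq, D.rot_size, zpow_natCast,
      ← D.rot_radius j, conjIf_false]

theorem ref_tile {f : ℂ ≃ᵢ ℂ} (hf : ∀ z, f z = 1 * conjIf true z + D.refPart) (j : Fin N) :
    ∃ z ∈ planeLattice σ,
      (D.tile j).map f = ((D.tile (T.refIdx j)).turn (T.refTurn j)).shift z := by
  refine ⟨_, ⟨(T.refShift j).1, (T.refShift j).2, rfl⟩, ext_radius ?_ ?_ ?_⟩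
  · exact (D.size_eq j).trans ((D.ref_size j).symm.trans (D.size_eq _).symm)
  · simpa [RegularPolygon.map, hf] using D.ref_center j
  · rw [map_radius hf, shift_radius, turn_radius, D.size_eq, D.ref_size, zpow_natCast,
      ← D.ref_radius j, conjIf_true, one_mul]

theorem exists_rot : ∃ f ∈ (D.toMotif.tess σ).Aut,
    ∀ z, f z = σ * conjIf false z + D.rotPart := by
  obtain ⟨f, hf⟩ := IsometryEquiv.exists_of_norm_eq_one D.lattice.norm_eq_one D.rotPart false
  refine ⟨f, ?_, hf⟩
  have hpow : ∀ (k : ℕ) (z : ℂ),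
      (f ^ k) z = σ ^ k * z + (∑ i ∈ Finset.range k, σ ^ i) * D.rotPart := by
    intro k
    induction k with
    | zero => intro z; simp
    | succ k ih =>
      intro z
      rw [pow_succ', IsometryEquiv.mul_apply, ih, hf, conjIf_false, geom_sum_succ]
      ring
  -- The vanishing geometric sum removes the translation part of the m-th power, so the rotation has
  -- order dividing m whatever its centre.
  have hsum : ∑ i ∈ Finset.range m, σ ^ i = 0 := by
    have h := mul_geom_sum σ m
    rw [D.lattice.pow_eq_one, sub_self] at h
    exact (mul_eq_zero.1 h).resolve_left (sub_ne_zero.2 D.lattice.ne_one)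
  refine mem_aut_of_pow (k := m - 1) (zero_mem_planeLattice σ) ?_
    (map_mem_of_tiles hf (fun z hz => D.lattice.mul_mem hz) fun j => ?_)
  · rw [Nat.sub_add_cancel D.lattice.pos, trans_zero]
    refine IsometryEquiv.ext fun z => ?_
    rw [hpow, hsum, D.lattice.pow_eq_one]
    simp
  · obtain ⟨z, hz, h⟩ := D.rot_tile hf j
    rw [h]
    exact shift_mem hz (turn_mem _ (tile_mem _))

/-- The isometry may be a glide reflection. Its square is the translation by `refPart` plus its
conjugate, which `refPart_mem` places in the lattice. -/
theorem exists_ref : ∃ f ∈ (D.toMotif.tess σ).Aut,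
    ∀ z, f z = 1 * conjIf true z + D.refPart := by
  obtain ⟨f, hf⟩ := IsometryEquiv.exists_of_norm_eq_one norm_one D.refPart true
  refine ⟨f, mem_aut_of_pow (k := 1) D.refPart_mem ?_
    (map_mem_of_tiles hf (fun z hz => ?_) fun j => ?_), hf⟩
  · refine IsometryEquiv.ext fun z => ?_
    rw [pow_succ, pow_one, IsometryEquiv.mul_apply, hf, hf, trans_apply]
    simp only [conjIf_true, map_add, _root_.map_mul, Complex.conj_conj, map_one]
    ring
  · rw [one_mul]
    exact D.lattice.conjIf_mem true hz
  · obtain ⟨z, hz, h⟩ := D.ref_tile hf j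
    rw [h]
    exact shift_mem hz (turn_mem _ (tile_mem _))

/-! ### Linear parts of the symmetries. -/

/-- All linear parts occur. -/
theorem exists_mem_aut (k : ℕ) (s : Bool) : ∃ f ∈ (D.toMotif.tess σ).Aut, ∃ b,
    ∀ z, f z = σ ^ k * conjIf s z + b := by
  induction k with
  | zero =>
    cases s
    · exact ⟨1, Subgroup.one_mem _, 0, fun z => by simp⟩
    · obtain ⟨f, hf, h⟩ := D.exists_ref
      exact ⟨f, hf, D.refPart, fun z => by rw [h, pow_zero]⟩
  | succ k ih =>
    obtain ⟨f, hf, b, h⟩ := ih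
    obtain ⟨g, hg, h'⟩ := D.exists_rot
    refine ⟨g * f, Subgroup.mul_mem _ hg hf, σ * b + D.rotPart, fun z => ?_⟩
    rw [IsometryEquiv.mul_apply, h', h, conjIf_false]
    ring

/-- Only the linear parts that preserve the lattice occur. -/
theorem exists_eq_pow {f : ℂ ≃ᵢ ℂ} (hf : f ∈ (D.toMotif.tess σ).Aut) {a b : ℂ} {s : Bool}
    (hfab : ∀ z, f z = a * conjIf s z + b) : ∃ k : ℕ, a = σ ^ k := by
  -- Conjugation fixes 1, so the linear part sends 1 to a whether or not f reverses orientation.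
  have h1 : trans a = f * trans 1 * f⁻¹ := by
    rw [eq_mul_inv_iff_mul_eq]
    refine IsometryEquiv.ext fun z => ?_
    simp only [IsometryEquiv.mul_apply, trans_apply, hfab, map_add, map_one]
    ring
  have h2 : trans a ∈ (D.toMotif.tess σ).Aut := by
    rw [h1]
    exact Subgroup.mul_mem _ (Subgroup.mul_mem _ hf (trans_mem_aut (one_mem_planeLattice σ)))
      (Subgroup.inv_mem _ hf)
  refine D.lattice.unit a (D.mem_of_translation a h2) ?_
  have h3 := f.isometry.dist_eq 1 0
  simpa [hfab, dist_eq_norm] using h3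

/-- Two motifs over the same lattice realize the same linear parts; this is the link between τ and
τ*. -/
theorem exists_trans_mul_mem {N' M' : ℕ} {T' : FlagTable N' M'} (D' : SymmetricMotif σ m T')
    {f : ℂ ≃ᵢ ℂ} (hf : f ∈ (D.toMotif.tess σ).Aut) :
    ∃ b, trans b * f ∈ (D'.toMotif.tess σ).Aut := by
  obtain ⟨a, b, s, -, hfab⟩ := f.exists_conjIf
  obtain ⟨k, rfl⟩ := D.exists_eq_pow hf hfab
  obtain ⟨g, hg, c, hgc⟩ := D'.exists_mem_aut k s
  refine ⟨c - b, ?_⟩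
  convert hg using 1
  refine IsometryEquiv.ext fun z => ?_
  rw [IsometryEquiv.mul_apply, trans_apply, hfab, hgc]
  ring

theorem exists_rigid_flag : ∃ Φ : (D.toMotif.tess σ).Flag,
    ∀ f : (D.toMotif.tess σ).Aut, f • Φ = Φ → f = 1 :=
  ⟨flag _ (tile_mem ⟨0, D.nonempty⟩) false, fun f hf => eq_one_of_smul_flag f hf⟩

/-! Counting flag orbits. -/

/-- The rooted tile with the given label. -/
def labelled (x : Fin N × ℤ × Bool) : RegularPolygon := (D.tile x.1).turn x.2.1

theorem labelled_mem (x : Fin N × ℤ × Bool) : D.labelled x ∈ D.toMotif.rooted σ :=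
  turn_mem _ (tile_mem _)

theorem labelled_eq_of_same {x y : Fin N × ℤ × Bool} (h : T.Same x y) :
    D.labelled x = D.labelled y := by
  obtain ⟨i, k, s⟩ := x
  obtain ⟨j, l, t⟩ := y
  obtain ⟨h1, h2, h3⟩ := h
  dsimp only at h1 h2 h3
  subst h1
  rw [← D.size_eq] at h2
  rw [labelled, labelled, ← turn_emod _ k (D.proper i).ne_zero,
    ← turn_emod _ l (D.proper i).ne_zero, h2]

theorem equivalent_rot (x : Fin N × ℤ × Bool) :
    D.Equivalent σ (D.labelled x) x.2.2 (D.labelled (T.rot x)) (T.rot x).2.2 := by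
  obtain ⟨f, hf, h⟩ := D.exists_rot
  have h1 := equivalent_map hf h (D.labelled x) x.2.2
  obtain ⟨z, hz, h2⟩ := D.rot_tile h x.1
  rw [labelled, map_turn h, h2, turn_shift, turn_turn, orient_false, one_mul,
    Bool.false_xor] at h1
  refine h1.trans (D.labelled_mem _) ?_
  exact (equivalent_shift hz _ _).symm (D.labelled_mem (T.rot x))

theorem equivalent_ref (x : Fin N × ℤ × Bool) :
    D.Equivalent σ (D.labelled x) x.2.2 (D.labelled (T.ref x)) (T.ref x).2.2 := by
  obtain ⟨f, hf, h⟩ := D.exists_ref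
  have h1 := equivalent_map hf h (D.labelled x) x.2.2
  obtain ⟨z, hz, h2⟩ := D.ref_tile h x.1
  rw [labelled, map_turn h, h2, turn_shift, turn_turn, orient_true, neg_one_mul,
    Bool.true_xor, ← sub_eq_add_neg] at h1
  refine h1.trans (D.labelled_mem _) ?_
  exact (equivalent_shift hz _ _).symm (D.labelled_mem (T.ref x))

theorem equivalent_refl (P : RegularPolygon) (s : Bool) : D.Equivalent σ P s P s := by
  simpa [shift_zero] using equivalent_shift (D := D.toMotif) (zero_mem_planeLattice σ) P s

theorem equivalent_iterate_rot (a : ℕ) (x : Fin N × ℤ × Bool) :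
    D.Equivalent σ (D.labelled x) x.2.2 (D.labelled (T.rot^[a] x)) (T.rot^[a] x).2.2 := by
  induction a with
  | zero => exact D.equivalent_refl _ _
  | succ a ih =>
    rw [Function.iterate_succ_apply']
    exact ih.trans (D.labelled_mem _) (D.equivalent_rot _)

/-- A lattice translation brings the tile to the motif and the corner number is reduced modulo the
number of corners; the finite check `Covers` then applies. -/
theorem exists_equivalent_rep (hT : T.Covers m) {P : RegularPolygon} (hP : P ∈ D.rooted σ)
    (s : Bool) : ∃ i, D.Equivalent σ P s (D.labelled (T.repLabel i)) (T.rep i).2.2 := by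
  obtain ⟨j, k, z, hz, rfl⟩ := hP
  have hn := (D.proper j).ne_zero
  have h0 : 0 ≤ k % (D.tile j).n := Int.emod_nonneg _ (by exact_mod_cast hn)
  have h1 : k % (D.tile j).n < (D.tile j).n :=
    Int.emod_lt_of_pos _ (by exact_mod_cast Nat.pos_of_ne_zero hn)
  have h2 : (k % (D.tile j).n).toNat < T.size j := by
    rw [← D.size_eq]; omega
  obtain ⟨i, a, b, h⟩ := hT j ⟨_, h2⟩ s
  refine ⟨i, ?_⟩
  have h3 : (D.tile j).turn k = D.labelled (j, ((k % (D.tile j).n).toNat : ℤ), s) := by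
    rw [labelled, Int.toNat_of_nonneg h0, turn_emod _ k hn]
  have hmem := D.labelled_mem (j, ((k % (D.tile j).n).toNat : ℤ), s)
  rw [h3]
  refine ((equivalent_shift hz _ s).symm hmem).trans (shift_mem hz hmem) ?_
  rw [← D.labelled_eq_of_same h, show (T.rep i).2.2 = (T.repLabel i).2.2 from rfl, ← h.2.2]
  refine Equivalent.trans hmem ?_ (D.equivalent_iterate_rot a _)
  cases b
  · exact D.equivalent_refl _ _
  · exact D.equivalent_ref (j, ((k % (D.tile j).n).toNat : ℤ), s)

theorem numFlagOrbits_eq (hT : T.Covers m)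
    (hsep : ∀ i i' : Fin M, i < i' → ¬ D.Equivalent σ (D.labelled (T.repLabel i)) (T.rep i).2.2
      (D.labelled (T.repLabel i')) (T.rep i').2.2) :
    (D.toMotif.tess σ).numFlagOrbits = M := by
  let F : Fin M → MulAction.orbitRel.Quotient (D.toMotif.tess σ).Aut (D.toMotif.tess σ).Flag :=
    fun i => Quotient.mk _ (flag _ (D.labelled_mem (T.repLabel i)) (T.rep i).2.2)
  have hF : Function.Bijective F := by
    constructor
    · intro i i' h
      rcases lt_trichotomy i i' with hlt | rfl | hlt
      · exact absurd ((equivalent_iff (D.labelled_mem _) (D.labelled_mem _)).2 h) (hsep _ _ hlt)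
      · rfl
      · exact absurd ((equivalent_iff (D.labelled_mem _) (D.labelled_mem _)).2 h.symm)
          (hsep _ _ hlt)
    · rintro ⟨Φ⟩
      obtain ⟨P, hP, s, rfl⟩ := exists_flag_eq Φ
      obtain ⟨i, hi⟩ := D.exists_equivalent_rep hT hP s
      exact ⟨i, ((equivalent_iff hP (D.labelled_mem _)).1 hi).symm⟩
  rw [numFlagOrbits, ← ENat.card_congr (Equiv.ofBijective F hF), ENat.card_eq_coe_fintype_card,
    Fintype.card_fin]

/-- Symmetries preserve the size of a face. If the directions agree, the symmetry preserves
orientation and its linear part is some σᵏ; comparing radii within one tile gives ζᵈ = σᵏ, where d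
is the difference of corner numbers, and the m-th power of the right side is 1. -/
theorem not_equivalent_of_separated {i i' : Fin M} (h : T.Separated m i i') :
    ¬ D.Equivalent σ (D.labelled (T.repLabel i)) (T.rep i).2.2
      (D.labelled (T.repLabel i')) (T.rep i').2.2 := by
  rintro ⟨f, hf, a, b, t, hfab, hP, ht⟩
  rcases h with h | ⟨h1, h2, h3⟩
  · have := congrArg RegularPolygon.n hP
    exact h ((D.size_eq _).symm.trans (this.trans (D.size_eq _)))
  · have ht : t = false := by
      rw [h2] at ht
      cases t <;> cases h : (T.rep i').2.2 <;> simp [h] at ht ⊢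
    subst ht
    obtain ⟨k, rfl⟩ := D.exists_eq_pow hf hfab
    have hr := map_radius hfab (D.labelled (T.repLabel i))
    rw [hP] at hr
    simp only [labelled, FlagTable.repLabel, turn_radius, conjIf_false] at hr
    rw [← h1] at hr
    have hn := (D.proper (T.rep i).1).ne_zero
    have hp := root_isPrimitiveRoot hn
    have hr' : root (D.tile (T.rep i).1).n ^ (((T.rep i').2.1 : ℤ) - (T.rep i).2.1) = σ ^ k := by
      rw [zpow_sub₀ (root_ne_zero _), div_eq_iff (zpow_ne_zero _ (root_ne_zero _))]
      apply mul_left_cancel₀ (D.proper (T.rep i).1).2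
      rw [hr]
      ring
    apply h3
    rw [← D.size_eq, ← hp.zpow_eq_one_iff_dvd, mul_comm, zpow_mul, hr', zpow_natCast, ← pow_mul,
      mul_comm k, pow_mul, D.lattice.pow_eq_one, one_pow]

end SymmetricMotif

/-! ### Translations of a periodic tessellation -/

namespace Motif

open Tessellation RegularPolygon

/-- The n-th power of the radius does not depend on the chosen corner and is unchanged by
translation, so it tells apart differently turned n-gons. -/
theorem exists_of_mem_translations {N : ℕ} {D : Motif N} {σ u : ℂ}
    (hu : u ∈ (D.tess σ).translations) (j : Fin N) :
    ∃ i, ∃ z ∈ planeLattice σ, (D.tile j).n = (D.tile i).n ∧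
      (D.tile j).center + u = (D.tile i).center + z ∧
      (D.tile j).radius ^ (D.tile j).n = (D.tile i).radius ^ (D.tile j).n := by
  have h := map_mem hu (tile_mem (D := D) (σ := σ) j)
  rw [map_trans] at h
  obtain ⟨i, k, z, hz, h⟩ := h
  have hn : (D.tile j).n = (D.tile i).n := by simpa using congrArg RegularPolygon.n h
  have hr := congrArg radius h
  simp only [shift_radius, turn_radius] at hr
  refine ⟨i, z, hz, hn, congrArg RegularPolygon.center h, ?_⟩
  rw [hr, mul_pow, ← zpow_natCast (root _ ^ k), zpow_comm, zpow_natCast, hn,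
    (root_isPrimitiveRoot (D.proper i).ne_zero).pow_eq_one, one_zpow, mul_one]

/-- If one of the tiles is not a translate of any other, then all translational symmetries belong
to the lattice. -/
theorem mem_of_mem_translations {N : ℕ} {D : Motif N} {σ : ℂ} (j : Fin N)
    (hj : ∀ i, (D.tile j).n = (D.tile i).n →
      (D.tile j).radius ^ (D.tile j).n = (D.tile i).radius ^ (D.tile j).n → i = j) :
    ∀ u ∈ (D.tess σ).translations, u ∈ planeLattice σ := by
  intro u hu
  obtain ⟨i, z, hz, hn, hc, hr⟩ := exists_of_mem_translations hu j
  rw [hj i hn hr] at hc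
  rwa [add_left_cancel hc]

end Motif

theorem RegularPolygon.isProper_of_sideSq_ne_zero {P : RegularPolygon} (hn : 3 ≤ P.n)
    (h : P.sideSq ≠ 0) : P.IsProper :=
  ⟨hn, fun h' => h (by simp [RegularPolygon.sideSq, h'])⟩

/-! ### The square and the triangular lattice -/

open RegularPolygon ArchType

/-- With the explicit roots of unity below, the geometric checks on the tiles become polynomial
identities modulo such relations and i² = -1. -/
theorem sqrt_three_sq : ((√3 : ℝ) : ℂ) ^ 2 = 3 := by
  rw [← Complex.ofReal_pow, Real.sq_sqrt (by norm_num)]; norm_num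

theorem sqrt_two_sq : ((√2 : ℝ) : ℂ) ^ 2 = 2 := by
  rw [← Complex.ofReal_pow, Real.sq_sqrt (by norm_num)]; norm_num

theorem omega_eq : omega = (1 + (√3 : ℝ) * Complex.I) / 2 := by
  apply Complex.ext <;> simp [omega]

theorem mk_eq (x y : ℝ) : (⟨x, y⟩ : ℂ) = x + y * Complex.I := Complex.mk_eq_add_mul_I x y

theorem omega_sq : omega ^ 2 = omega - 1 := by
  rw [omega_eq]
  linear_combination (Complex.I ^ 2 / 4) * sqrt_three_sq + (3 / 4) * Complex.I_sq

theorem conj_omega : (starRingEnd ℂ) omega = 1 - omega := by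
  rw [omega_eq]
  simp [Complex.conj_ofReal, map_ofNat]
  ring

theorem root_eq (n : ℕ) (x y : ℝ) (hx : Real.cos (2 * Real.pi / n) = x)
    (hy : Real.sin (2 * Real.pi / n) = y) : root n = x + y * Complex.I := by
  rw [root, show (2 * (Real.pi : ℂ) * Complex.I / (n : ℂ)) =
    ((2 * Real.pi / n : ℝ) : ℂ) * Complex.I by push_cast; ring, Complex.exp_mul_I,
    ← Complex.ofReal_cos, ← Complex.ofReal_sin, hx, hy]

theorem root_four : root 4 = Complex.I := by
  rw [root_eq 4 0 1]
  · simp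
  · rw [show 2 * Real.pi / (4 : ℕ) = Real.pi / 2 by push_cast; ring, Real.cos_pi_div_two]
  · rw [show 2 * Real.pi / (4 : ℕ) = Real.pi / 2 by push_cast; ring, Real.sin_pi_div_two]

theorem root_six : root 6 = omega := by
  rw [root_eq 6 (1 / 2) (√3 / 2), omega_eq]
  · push_cast; ring
  · rw [show 2 * Real.pi / (6 : ℕ) = Real.pi / 3 by push_cast; ring, Real.cos_pi_div_three]
  · rw [show 2 * Real.pi / (6 : ℕ) = Real.pi / 3 by push_cast; ring, Real.sin_pi_div_three]

theorem root_three : root 3 = omega - 1 := by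
  rw [← omega_sq, ← root_six, root, root, ← Complex.exp_nat_mul]
  congr 1
  push_cast
  ring

theorem root_eight : root 8 = (√2 : ℝ) / 2 * (1 + Complex.I) := by
  rw [root_eq 8 (√2 / 2) (√2 / 2)]
  · push_cast; ring
  · rw [show 2 * Real.pi / (8 : ℕ) = Real.pi / 4 by push_cast; ring, Real.cos_pi_div_four]
  · rw [show 2 * Real.pi / (8 : ℕ) = Real.pi / 4 by push_cast; ring, Real.sin_pi_div_four]

theorem root_twelve : root 12 = ((√3 : ℝ) + Complex.I) / 2 := by
  rw [root_eq 12 (√3 / 2) (1 / 2)]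
  · push_cast; ring
  · rw [show 2 * Real.pi / (12 : ℕ) = Real.pi / 6 by push_cast; ring, Real.cos_pi_div_six]
  · rw [show 2 * Real.pi / (12 : ℕ) = Real.pi / 6 by push_cast; ring, Real.sin_pi_div_six]

theorem isSymmetricLattice_I : IsSymmetricLattice Complex.I 4 where
  pos := by norm_num
  pow_eq_one := Complex.I_pow_four
  ne_one h := by simpa using congrArg Complex.re h
  mul_self_mem := ⟨-1, 0, by simp⟩
  conj_mem := ⟨0, -1, by simp⟩
  unit := by
    rintro _ ⟨a, b, rfl⟩ h
    have h1 : a ^ 2 + b ^ 2 = 1 := by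
      have h2 := Complex.sq_norm ((a : ℂ) + b * Complex.I)
      rw [h, Complex.normSq_apply] at h2
      simp at h2
      have h3 : (a : ℝ) ^ 2 + (b : ℝ) ^ 2 = 1 := by linarith
      exact_mod_cast h3
    have ha : -1 ≤ a ∧ a ≤ 1 := ⟨by nlinarith [sq_nonneg b], by nlinarith [sq_nonneg b]⟩
    have hb : -1 ≤ b ∧ b ≤ 1 := ⟨by nlinarith [sq_nonneg a], by nlinarith [sq_nonneg a]⟩
    obtain ⟨ha1, ha2⟩ := ha
    obtain ⟨hb1, hb2⟩ := hb
    interval_cases a <;> interval_cases b <;> simp at h1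
    · exact ⟨2, by simp⟩
    · exact ⟨3, by simp [pow_succ]⟩
    · exact ⟨1, by simp⟩
    · exact ⟨0, by simp⟩

theorem isSymmetricLattice_omega : IsSymmetricLattice omega 6 where
  pos := by norm_num
  pow_eq_one := by
    -- The factorization X⁶ - 1 = (X² - X + 1)(X⁴ + X³ - X - 1).
    linear_combination (omega ^ 4 + omega ^ 3 - omega - 1) * omega_sq
  ne_one h := by
    have h1 := congrArg Complex.re h
    norm_num [omega] at h1
  mul_self_mem := ⟨-1, 1, by push_cast; linear_combination omega_sq⟩
  conj_mem := ⟨1, -1, by rw [conj_omega]; push_cast; ring⟩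
  unit := by
    rintro _ ⟨a, b, rfl⟩ h
    have h1 : a ^ 2 + a * b + b ^ 2 = 1 := by
      have h2 := Complex.sq_norm ((a : ℂ) + b * omega)
      rw [h, Complex.normSq_apply] at h2
      simp [omega] at h2
      have h4 : √3 ^ 2 = 3 := Real.sq_sqrt (by norm_num)
      have h3 : (a : ℝ) ^ 2 + a * b + (b : ℝ) ^ 2 = 1 := by
        linear_combination -h2 - (b : ℝ) ^ 2 / 4 * h4
      exact_mod_cast h3
    -- The identity 4(a² + ab + b²) = 3a² + (a + 2b)² gives 3a² ≤ 4, and symmetrically for b.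
    have ha : -1 ≤ a ∧ a ≤ 1 := ⟨by nlinarith [sq_nonneg (a + 2 * b)],
      by nlinarith [sq_nonneg (a + 2 * b)]⟩
    have hb : -1 ≤ b ∧ b ≤ 1 := ⟨by nlinarith [sq_nonneg (2 * a + b)],
      by nlinarith [sq_nonneg (2 * a + b)]⟩
    obtain ⟨ha1, ha2⟩ := ha
    obtain ⟨hb1, hb2⟩ := hb
    have h2 := omega_sq
    interval_cases a <;> interval_cases b <;> simp at h1
    · exact ⟨3, by push_cast; linear_combination (-omega - 1) * h2⟩
    · exact ⟨2, by push_cast; linear_combination - h2⟩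
    · exact ⟨4, by push_cast; linear_combination (-omega ^ 2 - omega) * h2⟩
    · exact ⟨1, by simp⟩
    · exact ⟨5, by push_cast; linear_combination (-omega ^ 3 - omega ^ 2 + 1) * h2⟩
    · exact ⟨0, by simp⟩

/-! ### The tables -/

/-- The symmetries of `(4.8²)` and representatives of its flag orbits. -/
def table_4_8_8 : FlagTable 2 3 where
  size := ![8, 4]
  rotIdx := ![0, 1]
  -- A quarter turn advances an octagon by two corners and a square by one.
  rotTurn := ![2, 1]
  rotShift := ![(0, 0), (-1, 0)]
  refIdx := ![0, 1]
  -- The first corner of the octagon has argument π/8; its conjugate, at -π/8, is corner 7.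
  refTurn := ![7, 2]
  refShift := ![(0, 0), (0, -1)]
  rep := ![(0, 0, false), (0, 1, false), (1, 0, false)]

/-- The symmetries of `(3.6.3.6)` and representatives of its flag orbits. -/
def table_3_6_3_6 : FlagTable 3 2 where
  size := ![6, 3, 3]
  rotIdx := ![0, 2, 1]
  rotTurn := ![1, 2, 2]
  rotShift := ![(0, 0), (-1, 0), (-1, 1)]
  refIdx := ![0, 2, 1]
  refTurn := ![0, 0, 0]
  refShift := ![(0, 0), (0, -1), (1, -1)]
  rep := ![(0, 0, false), (1, 0, false)]

/-- The symmetries of `(3.12²)` and representatives of its flag orbits. -/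
def table_3_12_12 : FlagTable 3 3 where
  size := ![12, 3, 3]
  rotIdx := ![0, 2, 1]
  rotTurn := ![2, 2, 2]
  rotShift := ![(0, 0), (-1, 0), (-1, 1)]
  refIdx := ![0, 2, 1]
  refTurn := ![11, 0, 0]
  refShift := ![(0, 0), (0, -1), (1, -1)]
  rep := ![(0, 0, false), (0, 1, false), (1, 0, false)]

/-- The symmetries of `(4.6.12)` and representatives of its flag orbits. -/
def table_4_6_12 : FlagTable 6 6 where
  size := ![12, 6, 6, 4, 4, 4]
  rotIdx := ![0, 2, 1, 4, 5, 3]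
  rotTurn := ![2, 4, 4, 0, 0, 2]
  rotShift := ![(0, 0), (-1, 0), (-1, 1), (0, 0), (0, 0), (-1, 0)]
  refIdx := ![0, 2, 1, 3, 5, 4]
  refTurn := ![11, 1, 1, 1, 3, 3]
  refShift := ![(0, 0), (0, -1), (1, -1), (0, 0), (1, -1), (0, -1)]
  rep := ![(0, 0, false), (0, 1, false), (1, 0, false), (1, 1, false), (3, 0, false),
    (3, 1, false)]

/-- The symmetries of `(3.4.6.4)` and representatives of its flag orbits. -/
def table_3_4_6_4 : FlagTable 6 4 where
  size := ![6, 3, 3, 4, 4, 4]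
  rotIdx := ![0, 2, 1, 4, 5, 3]
  rotTurn := ![1, 2, 2, 0, 0, 2]
  rotShift := ![(0, 0), (-1, 0), (-1, 1), (0, 0), (0, 0), (-1, 0)]
  refIdx := ![0, 2, 1, 3, 5, 4]
  refTurn := ![5, 1, 1, 1, 3, 3]
  refShift := ![(0, 0), (0, -1), (1, -1), (0, 0), (1, -1), (0, -1)]
  rep := ![(0, 0, false), (1, 0, false), (3, 0, false), (3, 1, false)]

/-- The symmetries of `(3².4.3.4)` and representatives of its flag orbits. -/
def table_3_3_4_3_4 : FlagTable 6 5 where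
  size := ![4, 4, 3, 3, 3, 3]
  rotIdx := ![0, 1, 4, 5, 3, 2]
  rotTurn := ![1, 1, 0, 0, 2, 1]
  rotShift := ![(0, 0), (-1, 0), (0, 0), (0, 0), (-1, 0), (-1, 0)]
  refIdx := ![1, 0, 5, 4, 3, 2]
  refTurn := ![1, 1, 0, 0, 0, 0]
  refShift := ![(0, 0), (1, 0), (1, 0), (1, 0), (0, 0), (0, 0)]
  rep := ![(0, 0, false), (0, 0, true), (2, 0, false), (2, 1, false), (2, 2, false)]

/-- The symmetries of `{4,4}` and representatives of its flag orbits. -/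
def table_4_4_4_4 : FlagTable 1 1 where
  size := ![4]
  rotIdx := ![0]
  rotTurn := ![1]
  rotShift := ![(-1, 0)]
  refIdx := ![0]
  refTurn := ![3]
  refShift := ![(0, -1)]
  rep := ![(0, 0, false)]

/-- The symmetries of `{3,6}` and representatives of its flag orbits. -/
def table_3_3_3_3_3_3 : FlagTable 2 1 where
  size := ![3, 3]
  rotIdx := ![1, 0]
  rotTurn := ![0, 1]
  rotShift := ![(-1, 0), (-1, 1)]
  refIdx := ![1, 0]
  refTurn := ![2, 2]
  refShift := ![(0, -1), (1, -1)]
  rep := ![(0, 0, false)]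

theorem covers_4_8_8 : table_4_8_8.Covers 4 := by decide +kernel
theorem covers_3_6_3_6 : table_3_6_3_6.Covers 6 := by decide +kernel
theorem covers_3_12_12 : table_3_12_12.Covers 6 := by decide +kernel
theorem covers_4_6_12 : table_4_6_12.Covers 6 := by decide +kernel
theorem covers_3_4_6_4 : table_3_4_6_4.Covers 6 := by decide +kernel
theorem covers_3_3_4_3_4 : table_3_3_4_3_4.Covers 4 := by decide +kernel
theorem covers_4_4_4_4 : table_4_4_4_4.Covers 4 := by decide +kernel
theorem covers_3_3_3_3_3_3 : table_3_3_3_3_3_3.Covers 6 := by decide +kernel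

theorem separated_4_8_8 : ∀ i i', i < i' → table_4_8_8.Separated 4 i i' := by decide +kernel
theorem separated_3_6_3_6 : ∀ i i', i < i' → table_3_6_3_6.Separated 6 i i' := by decide +kernel
theorem separated_3_12_12 : ∀ i i', i < i' → table_3_12_12.Separated 6 i i' := by decide +kernel
theorem separated_3_4_6_4 : ∀ i i', i < i' → table_3_4_6_4.Separated 6 i i' := by decide +kernel
-- The exceptional flags lie at consecutive corners of one hexagon. They differ by a turn through
-- π/3, which is an admissible linear part.
theorem separated_4_6_12 : ∀ i i', i < i' → table_4_6_12.Separated 6 i i' ∨ i = 2 ∧ i' = 3 := by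
  decide +kernel
-- The exceptional flags share a corner of a square and have opposite directions, whereas
-- `Separated` only compares flags of equal direction on the same tile.
theorem separated_3_3_4_3_4 : ∀ i i', i < i' →
    table_3_3_4_3_4.Separated 4 i i' ∨ i = 0 ∧ i' = 1 := by
  decide +kernel

/-! ### The motifs -/

/-- The tiles of `(4.8²)`. -/
def tiles_4_8_8 : Fin 2 → RegularPolygon :=
  let p := baseVertex t4_8_8
  ![⟨8, 0, p⟩, ⟨4, (1 + Complex.I) / 2, p⟩]

/-- The common side length is what identifies edges with sides in `exists_flag_eq`; being nonzero,
it also shows that the tiles are proper. -/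
theorem sideSq_4_8_8 (j : Fin 2) : (tiles_4_8_8 j).sideSq = ((√2 - 1 : ℝ) ^ 2 : ℂ) := by
  have hr := sqrt_two_sq
  have hI := Complex.I_sq
  fin_cases j <;>
    simp [tiles_4_8_8, sideSq, radius, baseVertex, mk_eq, root_eight, root_four,
      Complex.conj_ofReal, map_ofNat] <;>
    grind

theorem rot_center_4_8_8 (j : Fin 2) :
    Complex.I * (tiles_4_8_8 j).center + 0 =
      (tiles_4_8_8 (table_4_8_8.rotIdx j)).center +
        ((table_4_8_8.rotShift j).1 + (table_4_8_8.rotShift j).2 * Complex.I) := by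
  have hr := sqrt_two_sq
  have hI := Complex.I_sq
  fin_cases j <;>
    simp [tiles_4_8_8, table_4_8_8, baseVertex, mk_eq]
  grind

theorem rot_radius_4_8_8 (j : Fin 2) :
    Complex.I * (tiles_4_8_8 j).radius = (tiles_4_8_8 (table_4_8_8.rotIdx j)).radius *
      root (table_4_8_8.size j) ^ table_4_8_8.rotTurn j := by
  have hr := sqrt_two_sq
  have hI := Complex.I_sq
  fin_cases j <;>
    simp [tiles_4_8_8, table_4_8_8, radius, baseVertex, mk_eq, root_eight, root_four] <;>
    grind

theorem ref_center_4_8_8 (j : Fin 2) :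
    (starRingEnd ℂ) (tiles_4_8_8 j).center + (0) =
      (tiles_4_8_8 (table_4_8_8.refIdx j)).center +
        ((table_4_8_8.refShift j).1 + (table_4_8_8.refShift j).2 * Complex.I) := by
  have hr := sqrt_two_sq
  have hI := Complex.I_sq
  fin_cases j <;>
    simp [tiles_4_8_8, table_4_8_8, baseVertex, mk_eq, map_ofNat]
  grind

theorem ref_radius_4_8_8 (j : Fin 2) :
    (starRingEnd ℂ) (tiles_4_8_8 j).radius = (tiles_4_8_8 (table_4_8_8.refIdx j)).radius *
      root (table_4_8_8.size j) ^ table_4_8_8.refTurn j := by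
  have hr := sqrt_two_sq
  have hI := Complex.I_sq
  fin_cases j <;>
    simp [tiles_4_8_8, table_4_8_8, radius, baseVertex, mk_eq, root_eight, root_four,
      Complex.conj_ofReal, map_ofNat] <;>
    grind

/-- The motif of `(4.8²)`. -/
def motif_4_8_8 : SymmetricMotif Complex.I 4 table_4_8_8 where
  tile := tiles_4_8_8
  side := (√2 - 1 : ℝ) ^ 2
  proper j := by
    refine isProper_of_sideSq_ne_zero ?_ ?_
    · fin_cases j <;> simp [tiles_4_8_8]
    · rw [sideSq_4_8_8]
      have hr := sqrt_two_sq
      intro h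
      push_cast at h
      grind
  sideSq_eq := sideSq_4_8_8
  nonempty := by norm_num
  lattice := isSymmetricLattice_I
  size_eq j := by fin_cases j <;> rfl
  rotPart := 0
  rot_size := by decide
  rot_center := rot_center_4_8_8
  rot_radius := rot_radius_4_8_8
  refPart := 0
  refPart_mem := ⟨0, 0, by simp⟩
  ref_size := by decide
  ref_center := ref_center_4_8_8
  ref_radius := ref_radius_4_8_8
  -- There is only one class of octagons, so a translation moves the octagon at 0 by a lattice
  -- vector.
  mem_of_translation := Motif.mem_of_mem_translations 0 fun i hn hr => by
    fin_cases i <;> simp [tiles_4_8_8] at hn hr ⊢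

/-- The tiles of `(3.6.3.6)`. -/
def tiles_3_6_3_6 : Fin 3 → RegularPolygon :=
  let p := baseVertex t3_6_3_6
  ![⟨6, 0, p⟩, ⟨3, (1 + omega) / 3, p⟩, ⟨3, 2 * (1 + omega) / 3, 1 + omega - p⟩]

theorem sideSq_3_6_3_6 (j : Fin 3) : (tiles_3_6_3_6 j).sideSq = (1 / 4 : ℂ) := by
  have hr := sqrt_three_sq
  have hI := Complex.I_sq
  fin_cases j <;>
    simp [tiles_3_6_3_6, sideSq, radius, baseVertex, root_six, root_three, omega_eq,
      Complex.conj_ofReal, map_ofNat] <;>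
    grind

theorem rot_center_3_6_3_6 (j : Fin 3) :
    omega * (tiles_3_6_3_6 j).center + 0 =
      (tiles_3_6_3_6 (table_3_6_3_6.rotIdx j)).center +
        ((table_3_6_3_6.rotShift j).1 + (table_3_6_3_6.rotShift j).2 * omega) := by
  have hr := sqrt_three_sq
  have hI := Complex.I_sq
  fin_cases j <;>
    simp [tiles_3_6_3_6, table_3_6_3_6, baseVertex, omega_eq] <;>
    grind

theorem rot_radius_3_6_3_6 (j : Fin 3) :
    omega * (tiles_3_6_3_6 j).radius = (tiles_3_6_3_6 (table_3_6_3_6.rotIdx j)).radius *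
      root (table_3_6_3_6.size j) ^ table_3_6_3_6.rotTurn j := by
  have hr := sqrt_three_sq
  have hI := Complex.I_sq
  fin_cases j <;>
    simp [tiles_3_6_3_6, table_3_6_3_6, radius, baseVertex, root_six, root_three, omega_eq] <;>
    grind

theorem ref_center_3_6_3_6 (j : Fin 3) :
    (starRingEnd ℂ) (tiles_3_6_3_6 j).center + (0) =
      (tiles_3_6_3_6 (table_3_6_3_6.refIdx j)).center +
        ((table_3_6_3_6.refShift j).1 + (table_3_6_3_6.refShift j).2 * omega) := by
  have hr := sqrt_three_sq
  have hI := Complex.I_sq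
  fin_cases j <;>
    simp [tiles_3_6_3_6, table_3_6_3_6, baseVertex, omega_eq, Complex.conj_ofReal, map_ofNat] <;>
    grind

theorem ref_radius_3_6_3_6 (j : Fin 3) :
    (starRingEnd ℂ) (tiles_3_6_3_6 j).radius = (tiles_3_6_3_6 (table_3_6_3_6.refIdx j)).radius *
      root (table_3_6_3_6.size j) ^ table_3_6_3_6.refTurn j := by
  have hr := sqrt_three_sq
  have hI := Complex.I_sq
  fin_cases j <;>
    simp [tiles_3_6_3_6, table_3_6_3_6, radius, baseVertex, root_six, root_three, omega_eq,
      Complex.conj_ofReal, map_ofNat] <;>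
    grind

/-- The motif of `(3.6.3.6)`. -/
def motif_3_6_3_6 : SymmetricMotif omega 6 table_3_6_3_6 where
  tile := tiles_3_6_3_6
  side := 1 / 4
  proper j := by
    refine isProper_of_sideSq_ne_zero ?_ ?_
    · fin_cases j <;> simp [tiles_3_6_3_6]
    · rw [sideSq_3_6_3_6]
      have hr := sqrt_three_sq
      intro h
      grind
  sideSq_eq := sideSq_3_6_3_6
  nonempty := by norm_num
  lattice := isSymmetricLattice_omega
  size_eq j := by fin_cases j <;> rfl
  rotPart := 0
  rot_size := by decide
  rot_center := rot_center_3_6_3_6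
  rot_radius := rot_radius_3_6_3_6
  refPart := 0
  refPart_mem := ⟨0, 0, by simp⟩
  ref_size := by decide
  ref_center := ref_center_3_6_3_6
  ref_radius := ref_radius_3_6_3_6
  mem_of_translation := Motif.mem_of_mem_translations 0 fun i hn hr => by
    fin_cases i <;> simp [tiles_3_6_3_6] at hn hr ⊢

/-- The tiles of `(3.12²)`. -/
def tiles_3_12_12 : Fin 3 → RegularPolygon :=
  let p := baseVertex t3_12_12
  ![⟨12, 0, p⟩, ⟨3, (1 + omega) / 3, p⟩, ⟨3, 2 * (1 + omega) / 3, 1 + omega - p⟩]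

theorem sideSq_3_12_12 (j : Fin 3) : (tiles_3_12_12 j).sideSq = ((2 - √3 : ℝ) ^ 2 : ℂ) := by
  have hr := sqrt_three_sq
  have hI := Complex.I_sq
  fin_cases j <;>
    simp [tiles_3_12_12, sideSq, radius, baseVertex, mk_eq, root_twelve, root_three, omega_eq,
      Complex.conj_ofReal, map_ofNat] <;>
    grind

theorem rot_center_3_12_12 (j : Fin 3) :
    omega * (tiles_3_12_12 j).center + 0 =
      (tiles_3_12_12 (table_3_12_12.rotIdx j)).center +
        ((table_3_12_12.rotShift j).1 + (table_3_12_12.rotShift j).2 * omega) := by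
  have hr := sqrt_three_sq
  have hI := Complex.I_sq
  fin_cases j <;>
    simp [tiles_3_12_12, table_3_12_12, baseVertex, mk_eq, omega_eq] <;>
    grind

theorem rot_radius_3_12_12 (j : Fin 3) :
    omega * (tiles_3_12_12 j).radius = (tiles_3_12_12 (table_3_12_12.rotIdx j)).radius *
      root (table_3_12_12.size j) ^ table_3_12_12.rotTurn j := by
  have hr := sqrt_three_sq
  have hI := Complex.I_sq
  fin_cases j <;>
    simp [tiles_3_12_12, table_3_12_12, radius, baseVertex, mk_eq, root_twelve, root_three,
      omega_eq] <;>
    grind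

theorem ref_center_3_12_12 (j : Fin 3) :
    (starRingEnd ℂ) (tiles_3_12_12 j).center + (0) =
      (tiles_3_12_12 (table_3_12_12.refIdx j)).center +
        ((table_3_12_12.refShift j).1 + (table_3_12_12.refShift j).2 * omega) := by
  have hr := sqrt_three_sq
  have hI := Complex.I_sq
  fin_cases j <;>
    simp [tiles_3_12_12, table_3_12_12, baseVertex, mk_eq, omega_eq, Complex.conj_ofReal, map_ofNat]
      <;>
    grind

theorem ref_radius_3_12_12 (j : Fin 3) :
    (starRingEnd ℂ) (tiles_3_12_12 j).radius = (tiles_3_12_12 (table_3_12_12.refIdx j)).radius *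
      root (table_3_12_12.size j) ^ table_3_12_12.refTurn j := by
  have hr := sqrt_three_sq
  have hI := Complex.I_sq
  fin_cases j <;>
    simp [tiles_3_12_12, table_3_12_12, radius, baseVertex, mk_eq, root_twelve, root_three,
      omega_eq, Complex.conj_ofReal, map_ofNat] <;>
    grind

/-- The motif of `(3.12²)`. -/
def motif_3_12_12 : SymmetricMotif omega 6 table_3_12_12 where
  tile := tiles_3_12_12
  side := (2 - √3 : ℝ) ^ 2
  proper j := by
    refine isProper_of_sideSq_ne_zero ?_ ?_
    · fin_cases j <;> simp [tiles_3_12_12]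
    · rw [sideSq_3_12_12]
      have hr := sqrt_three_sq
      intro h
      push_cast at h
      grind
  sideSq_eq := sideSq_3_12_12
  nonempty := by norm_num
  lattice := isSymmetricLattice_omega
  size_eq j := by fin_cases j <;> rfl
  rotPart := 0
  rot_size := by decide
  rot_center := rot_center_3_12_12
  rot_radius := rot_radius_3_12_12
  refPart := 0
  refPart_mem := ⟨0, 0, by simp⟩
  ref_size := by decide
  ref_center := ref_center_3_12_12
  ref_radius := ref_radius_3_12_12
  mem_of_translation := Motif.mem_of_mem_translations 0 fun i hn hr => by
    fin_cases i <;> simp [tiles_3_12_12] at hn hr ⊢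

/-- The tiles of `(4.6.12)`. -/
def tiles_4_6_12 : Fin 6 → RegularPolygon :=
  let p := baseVertex t4_6_12
  ![⟨12, 0, p⟩, ⟨6, (1 + omega) / 3, p⟩, ⟨6, 2 * (1 + omega) / 3, 1 + omega - p⟩,
    ⟨4, 1 / 2, p⟩, ⟨4, omega / 2, omega * p⟩, ⟨4, omega ^ 2 / 2, omega ^ 2 * p⟩]

theorem sideSq_4_6_12 (j : Fin 6) : (tiles_4_6_12 j).sideSq = (((3 - √3) / 6 : ℝ) ^ 2 : ℂ) := by
  have hr := sqrt_three_sq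
  have hI := Complex.I_sq
  fin_cases j <;>
    simp [tiles_4_6_12, sideSq, radius, baseVertex, mk_eq, root_twelve, root_six, root_four,
      omega_eq, Complex.conj_ofReal, map_ofNat] <;>
    grind

theorem rot_center_4_6_12 (j : Fin 6) :
    omega * (tiles_4_6_12 j).center + 0 =
      (tiles_4_6_12 (table_4_6_12.rotIdx j)).center +
        ((table_4_6_12.rotShift j).1 + (table_4_6_12.rotShift j).2 * omega) := by
  have hr := sqrt_three_sq
  have hI := Complex.I_sq
  fin_cases j <;>
    simp [tiles_4_6_12, table_4_6_12, baseVertex, mk_eq, omega_eq] <;>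
    grind

theorem rot_radius_4_6_12 (j : Fin 6) :
    omega * (tiles_4_6_12 j).radius = (tiles_4_6_12 (table_4_6_12.rotIdx j)).radius *
      root (table_4_6_12.size j) ^ table_4_6_12.rotTurn j := by
  have hr := sqrt_three_sq
  have hI := Complex.I_sq
  fin_cases j <;>
    simp [tiles_4_6_12, table_4_6_12, radius, baseVertex, mk_eq, root_twelve, root_six, root_four,
      omega_eq] <;>
    grind

theorem ref_center_4_6_12 (j : Fin 6) :
    (starRingEnd ℂ) (tiles_4_6_12 j).center + (0) =
      (tiles_4_6_12 (table_4_6_12.refIdx j)).center +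
        ((table_4_6_12.refShift j).1 + (table_4_6_12.refShift j).2 * omega) := by
  have hr := sqrt_three_sq
  have hI := Complex.I_sq
  fin_cases j <;>
    simp [tiles_4_6_12, table_4_6_12, baseVertex, mk_eq, omega_eq, Complex.conj_ofReal, map_ofNat]
      <;>
    grind

theorem ref_radius_4_6_12 (j : Fin 6) :
    (starRingEnd ℂ) (tiles_4_6_12 j).radius = (tiles_4_6_12 (table_4_6_12.refIdx j)).radius *
      root (table_4_6_12.size j) ^ table_4_6_12.refTurn j := by
  have hr := sqrt_three_sq
  have hI := Complex.I_sq
  fin_cases j <;>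
    simp [tiles_4_6_12, table_4_6_12, radius, baseVertex, mk_eq, root_twelve, root_six, root_four,
      omega_eq, Complex.conj_ofReal, map_ofNat] <;>
    grind

/-- The motif of `(4.6.12)`. -/
def motif_4_6_12 : SymmetricMotif omega 6 table_4_6_12 where
  tile := tiles_4_6_12
  side := ((3 - √3) / 6 : ℝ) ^ 2
  proper j := by
    refine isProper_of_sideSq_ne_zero ?_ ?_
    · fin_cases j <;> simp [tiles_4_6_12]
    · rw [sideSq_4_6_12]
      have hr := sqrt_three_sq
      intro h
      push_cast at h
      grind
  sideSq_eq := sideSq_4_6_12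
  nonempty := by norm_num
  lattice := isSymmetricLattice_omega
  size_eq j := by fin_cases j <;> rfl
  rotPart := 0
  rot_size := by decide
  rot_center := rot_center_4_6_12
  rot_radius := rot_radius_4_6_12
  refPart := 0
  refPart_mem := ⟨0, 0, by simp⟩
  ref_size := by decide
  ref_center := ref_center_4_6_12
  ref_radius := ref_radius_4_6_12
  mem_of_translation := Motif.mem_of_mem_translations 0 fun i hn hr => by
    fin_cases i <;> simp [tiles_4_6_12] at hn hr ⊢

/-- The tiles of `(3.4.6.4)`. -/
def tiles_3_4_6_4 : Fin 6 → RegularPolygon :=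
  let p := baseVertex t3_4_6_4
  ![⟨6, 0, p⟩, ⟨3, (1 + omega) / 3, p⟩, ⟨3, 2 * (1 + omega) / 3, 1 + omega - p⟩,
    ⟨4, 1 / 2, p⟩, ⟨4, omega / 2, omega * p⟩, ⟨4, omega ^ 2 / 2, omega ^ 2 * p⟩]

theorem sideSq_3_4_6_4 (j : Fin 6) : (tiles_3_4_6_4 j).sideSq = (((√3 - 1) / 2 : ℝ) ^ 2 : ℂ) := by
  have hr := sqrt_three_sq
  have hI := Complex.I_sq
  fin_cases j <;>
    simp [tiles_3_4_6_4, sideSq, radius, baseVertex, mk_eq, root_six, root_four, root_three,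
      omega_eq, Complex.conj_ofReal, map_ofNat] <;>
    grind

theorem rot_center_3_4_6_4 (j : Fin 6) :
    omega * (tiles_3_4_6_4 j).center + 0 =
      (tiles_3_4_6_4 (table_3_4_6_4.rotIdx j)).center +
        ((table_3_4_6_4.rotShift j).1 + (table_3_4_6_4.rotShift j).2 * omega) := by
  have hr := sqrt_three_sq
  have hI := Complex.I_sq
  fin_cases j <;>
    simp [tiles_3_4_6_4, table_3_4_6_4, baseVertex, mk_eq, omega_eq] <;>
    grind

theorem rot_radius_3_4_6_4 (j : Fin 6) :
    omega * (tiles_3_4_6_4 j).radius = (tiles_3_4_6_4 (table_3_4_6_4.rotIdx j)).radius *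
      root (table_3_4_6_4.size j) ^ table_3_4_6_4.rotTurn j := by
  have hr := sqrt_three_sq
  have hI := Complex.I_sq
  fin_cases j <;>
    simp [tiles_3_4_6_4, table_3_4_6_4, radius, baseVertex, mk_eq, root_six, root_four, root_three,
      omega_eq] <;>
    grind

theorem ref_center_3_4_6_4 (j : Fin 6) :
    (starRingEnd ℂ) (tiles_3_4_6_4 j).center + (0) =
      (tiles_3_4_6_4 (table_3_4_6_4.refIdx j)).center +
        ((table_3_4_6_4.refShift j).1 + (table_3_4_6_4.refShift j).2 * omega) := by
  have hr := sqrt_three_sq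
  have hI := Complex.I_sq
  fin_cases j <;>
    simp [tiles_3_4_6_4, table_3_4_6_4, baseVertex, mk_eq, omega_eq, Complex.conj_ofReal, map_ofNat]
      <;>
    grind

theorem ref_radius_3_4_6_4 (j : Fin 6) :
    (starRingEnd ℂ) (tiles_3_4_6_4 j).radius = (tiles_3_4_6_4 (table_3_4_6_4.refIdx j)).radius *
      root (table_3_4_6_4.size j) ^ table_3_4_6_4.refTurn j := by
  have hr := sqrt_three_sq
  have hI := Complex.I_sq
  fin_cases j <;>
    simp [tiles_3_4_6_4, table_3_4_6_4, radius, baseVertex, mk_eq, root_six, root_four, root_three,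
      omega_eq, Complex.conj_ofReal, map_ofNat] <;>
    grind

/-- The motif of `(3.4.6.4)`. -/
def motif_3_4_6_4 : SymmetricMotif omega 6 table_3_4_6_4 where
  tile := tiles_3_4_6_4
  side := ((√3 - 1) / 2 : ℝ) ^ 2
  proper j := by
    refine isProper_of_sideSq_ne_zero ?_ ?_
    · fin_cases j <;> simp [tiles_3_4_6_4]
    · rw [sideSq_3_4_6_4]
      have hr := sqrt_three_sq
      intro h
      push_cast at h
      grind
  sideSq_eq := sideSq_3_4_6_4
  nonempty := by norm_num
  lattice := isSymmetricLattice_omega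
  size_eq j := by fin_cases j <;> rfl
  rotPart := 0
  rot_size := by decide
  rot_center := rot_center_3_4_6_4
  rot_radius := rot_radius_3_4_6_4
  refPart := 0
  refPart_mem := ⟨0, 0, by simp⟩
  ref_size := by decide
  ref_center := ref_center_3_4_6_4
  ref_radius := ref_radius_3_4_6_4
  mem_of_translation := Motif.mem_of_mem_translations 0 fun i hn hr => by
    fin_cases i <;> simp [tiles_3_4_6_4] at hn hr ⊢

/-- The tiles of `(3².4.3.4)`. -/
def tiles_3_3_4_3_4 : Fin 6 → RegularPolygon :=
  let p := baseVertex t3_3_4_3_4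
  let i := Complex.I
  ![⟨4, 0, p⟩, ⟨4, (1 + i) / 2, p⟩,
    ⟨3, (2 + i * p) / 3, p⟩, ⟨3, (1 - i * p) / 3, p⟩,
    ⟨3, i * (2 + i * p) / 3, i * p⟩, ⟨3, i * (1 - i * p) / 3, i * p⟩]

theorem sideSq_3_3_4_3_4 (j : Fin 6) : (tiles_3_3_4_3_4 j).sideSq = ((2 - √3 : ℝ) : ℂ) := by
  have hr := sqrt_three_sq
  have hI := Complex.I_sq
  fin_cases j <;>
    simp [tiles_3_3_4_3_4, sideSq, radius, baseVertex, mk_eq, root_four, root_three, omega_eq,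
      Complex.conj_ofReal, map_ofNat] <;>
    grind

theorem rot_center_3_3_4_3_4 (j : Fin 6) :
    Complex.I * (tiles_3_3_4_3_4 j).center + 0 =
      (tiles_3_3_4_3_4 (table_3_3_4_3_4.rotIdx j)).center +
        ((table_3_3_4_3_4.rotShift j).1 + (table_3_3_4_3_4.rotShift j).2 * Complex.I) := by
  have hr := sqrt_three_sq
  have hI := Complex.I_sq
  fin_cases j <;>
    simp [tiles_3_3_4_3_4, table_3_3_4_3_4, baseVertex, mk_eq] <;>
    grind

theorem rot_radius_3_3_4_3_4 (j : Fin 6) :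
    Complex.I * (tiles_3_3_4_3_4 j).radius = (tiles_3_3_4_3_4 (table_3_3_4_3_4.rotIdx j)).radius *
      root (table_3_3_4_3_4.size j) ^ table_3_3_4_3_4.rotTurn j := by
  have hr := sqrt_three_sq
  have hI := Complex.I_sq
  fin_cases j <;>
    simp [tiles_3_3_4_3_4, table_3_3_4_3_4, radius, baseVertex, mk_eq, root_four, root_three,
      omega_eq] <;>
    grind

theorem ref_center_3_3_4_3_4 (j : Fin 6) :
    (starRingEnd ℂ) (tiles_3_3_4_3_4 j).center + ((1 + Complex.I) / 2) =
      (tiles_3_3_4_3_4 (table_3_3_4_3_4.refIdx j)).center +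
        ((table_3_3_4_3_4.refShift j).1 + (table_3_3_4_3_4.refShift j).2 * Complex.I) := by
  have hr := sqrt_three_sq
  have hI := Complex.I_sq
  fin_cases j <;>
    simp [tiles_3_3_4_3_4, table_3_3_4_3_4, baseVertex, mk_eq, Complex.conj_ofReal, map_ofNat] <;>
    grind

theorem ref_radius_3_3_4_3_4 (j : Fin 6) :
    (starRingEnd ℂ) (tiles_3_3_4_3_4 j).radius = (tiles_3_3_4_3_4 (table_3_3_4_3_4.refIdx j)).radius
      *
      root (table_3_3_4_3_4.size j) ^ table_3_3_4_3_4.refTurn j := by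
  have hr := sqrt_three_sq
  have hI := Complex.I_sq
  fin_cases j <;>
    simp [tiles_3_3_4_3_4, table_3_3_4_3_4, radius, baseVertex, mk_eq, root_four, root_three,
      omega_eq, Complex.conj_ofReal, map_ofNat] <;>
    grind

/-- The motif of `(3².4.3.4)`. -/
def motif_3_3_4_3_4 : SymmetricMotif Complex.I 4 table_3_3_4_3_4 where
  tile := tiles_3_3_4_3_4
  side := (2 - √3 : ℝ)
  proper j := by
    refine isProper_of_sideSq_ne_zero ?_ ?_
    · fin_cases j <;> simp [tiles_3_3_4_3_4]
    · rw [sideSq_3_3_4_3_4]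
      have hr := sqrt_three_sq
      intro h
      push_cast at h
      grind
  sideSq_eq := sideSq_3_3_4_3_4
  nonempty := by norm_num
  lattice := isSymmetricLattice_I
  size_eq j := by fin_cases j <;> rfl
  rotPart := 0
  rot_size := by decide
  rot_center := rot_center_3_3_4_3_4
  rot_radius := rot_radius_3_3_4_3_4
  -- A glide reflection along the line of height 1/4 by the vector 1/2; it exchanges the two classes
  -- of squares, and its square is the translation by 1.
  refPart := (1 + Complex.I) / 2
  refPart_mem := ⟨1, 0, by simp [map_ofNat]; ring⟩
  ref_size := by decide
  ref_center := ref_center_3_3_4_3_4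
  ref_radius := ref_radius_3_3_4_3_4
  -- Both classes of squares pass the test on the number of corners. They are turned differently:
  -- the fourth powers of their radii have arguments 2π/3 and 4π/3.
  mem_of_translation := Motif.mem_of_mem_translations 0 fun i hn hr => by
    fin_cases i <;> simp [tiles_3_3_4_3_4] at hn hr ⊢
    have hs := sqrt_three_sq
    have hI := Complex.I_sq
    simp [radius, baseVertex, mk_eq] at hr
    grind

/-! ### The associated regular tessellations with origin o. -/

/-- The tiles of `{4,4}`. -/
def tiles_4_4_4_4 (o : ℂ) : Fin 1 → RegularPolygon :=
  ![⟨4, o + (1 + Complex.I) / 2, o⟩]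

theorem sideSq_4_4_4_4 (o : ℂ) (j : Fin 1) : (tiles_4_4_4_4 o j).sideSq = (1 : ℂ) := by
  have hI := Complex.I_sq
  fin_cases j
  simp [tiles_4_4_4_4, sideSq, radius, root_four, map_ofNat]
  grind

theorem rot_center_4_4_4_4 (o : ℂ) (j : Fin 1) :
    Complex.I * (tiles_4_4_4_4 o j).center + (o - Complex.I * o) =
      (tiles_4_4_4_4 o (table_4_4_4_4.rotIdx j)).center +
        ((table_4_4_4_4.rotShift j).1 + (table_4_4_4_4.rotShift j).2 * Complex.I) := by
  have hI := Complex.I_sq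
  fin_cases j
  simp [tiles_4_4_4_4, table_4_4_4_4]
  grind

theorem rot_radius_4_4_4_4 (o : ℂ) (j : Fin 1) :
    Complex.I * (tiles_4_4_4_4 o j).radius = (tiles_4_4_4_4 o (table_4_4_4_4.rotIdx j)).radius *
      root (table_4_4_4_4.size j) ^ table_4_4_4_4.rotTurn j := by
  have hI := Complex.I_sq
  fin_cases j
  simp [tiles_4_4_4_4, table_4_4_4_4, radius, root_four]
  grind

theorem ref_center_4_4_4_4 (o : ℂ) (j : Fin 1) :
    (starRingEnd ℂ) (tiles_4_4_4_4 o j).center + (o - (starRingEnd ℂ) o) =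
      (tiles_4_4_4_4 o (table_4_4_4_4.refIdx j)).center +
        ((table_4_4_4_4.refShift j).1 + (table_4_4_4_4.refShift j).2 * Complex.I) := by
  have hI := Complex.I_sq
  fin_cases j
  simp [tiles_4_4_4_4, table_4_4_4_4, map_ofNat]
  grind

theorem ref_radius_4_4_4_4 (o : ℂ) (j : Fin 1) :
    (starRingEnd ℂ) (tiles_4_4_4_4 o j).radius = (tiles_4_4_4_4 o (table_4_4_4_4.refIdx j)).radius *
      root (table_4_4_4_4.size j) ^ table_4_4_4_4.refTurn j := by
  have hI := Complex.I_sq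
  fin_cases j
  simp [tiles_4_4_4_4, table_4_4_4_4, radius, root_four, map_ofNat]
  grind

/-- The motif of `{4,4}`. -/
def motif_4_4_4_4 (o : ℂ) : SymmetricMotif Complex.I 4 table_4_4_4_4 where
  tile := tiles_4_4_4_4 o
  side := 1
  proper j := by
    refine isProper_of_sideSq_ne_zero ?_ ?_
    · fin_cases j; simp [tiles_4_4_4_4]
    · rw [sideSq_4_4_4_4]
      intro h
      grind
  sideSq_eq := sideSq_4_4_4_4 o
  nonempty := by norm_num
  lattice := isSymmetricLattice_I
  size_eq j := by fin_cases j; rfl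
  -- The rotation fixes o, and the reflection below is in the horizontal line through o.
  rotPart := o - Complex.I * o
  rot_size := by decide
  rot_center := rot_center_4_4_4_4 o
  rot_radius := rot_radius_4_4_4_4 o
  refPart := o - (starRingEnd ℂ) o
  refPart_mem := ⟨0, 0, by simp⟩
  ref_size := by decide
  ref_center := ref_center_4_4_4_4 o
  ref_radius := ref_radius_4_4_4_4 o
  mem_of_translation := Motif.mem_of_mem_translations 0 fun i hn hr => by
    fin_cases i; rfl

/-- The tiles of `{3,6}`. -/
def tiles_3_3_3_3_3_3 (o : ℂ) : Fin 2 → RegularPolygon :=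
  ![⟨3, o + (1 + omega) / 3, o⟩, ⟨3, o + 2 * (1 + omega) / 3, o + 1⟩]

theorem sideSq_3_3_3_3_3_3 (o : ℂ) (j : Fin 2) : (tiles_3_3_3_3_3_3 o j).sideSq = (1 : ℂ) := by
  have hr := sqrt_three_sq
  have hI := Complex.I_sq
  fin_cases j <;>
    simp [tiles_3_3_3_3_3_3, sideSq, radius, root_three, omega_eq, Complex.conj_ofReal, map_ofNat]
      <;>
    grind

theorem rot_center_3_3_3_3_3_3 (o : ℂ) (j : Fin 2) :
    omega * (tiles_3_3_3_3_3_3 o j).center + (o - omega * o) =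
      (tiles_3_3_3_3_3_3 o (table_3_3_3_3_3_3.rotIdx j)).center +
        ((table_3_3_3_3_3_3.rotShift j).1 + (table_3_3_3_3_3_3.rotShift j).2 * omega) := by
  have hr := sqrt_three_sq
  have hI := Complex.I_sq
  fin_cases j <;>
    simp [tiles_3_3_3_3_3_3, table_3_3_3_3_3_3, omega_eq] <;>
    grind

theorem rot_radius_3_3_3_3_3_3 (o : ℂ) (j : Fin 2) :
    omega * (tiles_3_3_3_3_3_3 o j).radius = (tiles_3_3_3_3_3_3 o (table_3_3_3_3_3_3.rotIdx
      j)).radius *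
      root (table_3_3_3_3_3_3.size j) ^ table_3_3_3_3_3_3.rotTurn j := by
  have hr := sqrt_three_sq
  have hI := Complex.I_sq
  fin_cases j <;>
    simp [tiles_3_3_3_3_3_3, table_3_3_3_3_3_3, radius, root_three, omega_eq] <;>
    grind

theorem ref_center_3_3_3_3_3_3 (o : ℂ) (j : Fin 2) :
    (starRingEnd ℂ) (tiles_3_3_3_3_3_3 o j).center + (o - (starRingEnd ℂ) o) =
      (tiles_3_3_3_3_3_3 o (table_3_3_3_3_3_3.refIdx j)).center +
        ((table_3_3_3_3_3_3.refShift j).1 + (table_3_3_3_3_3_3.refShift j).2 * omega) := by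
  have hr := sqrt_three_sq
  have hI := Complex.I_sq
  fin_cases j <;>
    simp [tiles_3_3_3_3_3_3, table_3_3_3_3_3_3, omega_eq, Complex.conj_ofReal, map_ofNat] <;>
    grind

theorem ref_radius_3_3_3_3_3_3 (o : ℂ) (j : Fin 2) :
    (starRingEnd ℂ) (tiles_3_3_3_3_3_3 o j).radius = (tiles_3_3_3_3_3_3 o (table_3_3_3_3_3_3.refIdx
      j)).radius *
      root (table_3_3_3_3_3_3.size j) ^ table_3_3_3_3_3_3.refTurn j := by
  have hr := sqrt_three_sq
  have hI := Complex.I_sq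
  fin_cases j <;>
    simp [tiles_3_3_3_3_3_3, table_3_3_3_3_3_3, radius, root_three, omega_eq, Complex.conj_ofReal,
      map_ofNat] <;>
    grind

/-- The motif of `{3,6}`. -/
def motif_3_3_3_3_3_3 (o : ℂ) : SymmetricMotif omega 6 table_3_3_3_3_3_3 where
  tile := tiles_3_3_3_3_3_3 o
  side := 1
  proper j := by
    refine isProper_of_sideSq_ne_zero ?_ ?_
    · fin_cases j <;> simp [tiles_3_3_3_3_3_3]
    · rw [sideSq_3_3_3_3_3_3]
      have hr := sqrt_three_sq
      intro h
      grind
  sideSq_eq := sideSq_3_3_3_3_3_3 o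
  nonempty := by norm_num
  lattice := isSymmetricLattice_omega
  size_eq j := by fin_cases j <;> rfl
  rotPart := o - omega * o
  rot_size := by decide
  rot_center := rot_center_3_3_3_3_3_3 o
  rot_radius := rot_radius_3_3_3_3_3_3 o
  refPart := o - (starRingEnd ℂ) o
  refPart_mem := ⟨0, 0, by simp⟩
  ref_size := by decide
  ref_center := ref_center_3_3_3_3_3_3 o
  ref_radius := ref_radius_3_3_3_3_3_3 o
  -- The two classes of triangles point in opposite directions, and the cubes of their radii are
  -- opposite.
  mem_of_translation := Motif.mem_of_mem_translations 0 fun i hn hr => by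
    fin_cases i <;> simp [tiles_3_3_3_3_3_3] at hn hr ⊢
    have hw := omega_sq
    simp [radius] at hr
    grind

/-! ### Counting the flag orbits -/

theorem numFlagOrbits_motif_4_8_8 :
    (motif_4_8_8.toMotif.tess Complex.I).numFlagOrbits = (3 : ℕ) :=
  motif_4_8_8.numFlagOrbits_eq covers_4_8_8 fun i i' h =>
    motif_4_8_8.not_equivalent_of_separated (separated_4_8_8 i i' h)

theorem numFlagOrbits_motif_3_6_3_6 :
    (motif_3_6_3_6.toMotif.tess omega).numFlagOrbits = (2 : ℕ) :=
  motif_3_6_3_6.numFlagOrbits_eq covers_3_6_3_6 fun i i' h =>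
    motif_3_6_3_6.not_equivalent_of_separated (separated_3_6_3_6 i i' h)

theorem numFlagOrbits_motif_3_12_12 :
    (motif_3_12_12.toMotif.tess omega).numFlagOrbits = (3 : ℕ) :=
  motif_3_12_12.numFlagOrbits_eq covers_3_12_12 fun i i' h =>
    motif_3_12_12.not_equivalent_of_separated (separated_3_12_12 i i' h)

theorem numFlagOrbits_motif_3_4_6_4 :
    (motif_3_4_6_4.toMotif.tess omega).numFlagOrbits = (4 : ℕ) :=
  motif_3_4_6_4.numFlagOrbits_eq covers_3_4_6_4 fun i i' h =>
    motif_3_4_6_4.not_equivalent_of_separated (separated_3_4_6_4 i i' h)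

theorem numFlagOrbits_motif_4_4_4_4 (o : ℂ) :
    ((motif_4_4_4_4 o).toMotif.tess Complex.I).numFlagOrbits = (1 : ℕ) :=
  (motif_4_4_4_4 o).numFlagOrbits_eq covers_4_4_4_4 fun i i' h => by omega

theorem numFlagOrbits_motif_3_3_3_3_3_3 (o : ℂ) :
    ((motif_3_3_3_3_3_3 o).toMotif.tess omega).numFlagOrbits = (1 : ℕ) :=
  (motif_3_3_3_3_3_3 o).numFlagOrbits_eq covers_3_3_3_3_3_3 fun i i' h => by omega

/-- The centre of a hexagon of `(4.6.12)` is not the centre of a sixfold rotation. -/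
theorem one_sub_omega_mul_not_mem : (1 - omega) * ((1 + omega) / 3) ∉ planeLattice omega := by
  rintro ⟨a, b, h⟩
  have h1 : (2 - omega) = 3 * a + 3 * b * omega := by
    linear_combination 3 * h + omega_sq
  have h2 := congrArg Complex.im h1
  have h3 : √3 ≠ 0 := by simp
  simp [omega] at h2
  have h4 : ((3 * b + 1 : ℤ) : ℝ) = 0 := by
    push_cast
    apply mul_right_cancel₀ h3
    linarith
  have h5 : 3 * b + 1 = 0 := by exact_mod_cast h4
  omega

/-- A symmetry joining the two exceptional flags would be the rotation through π/3 about the centre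
(1 + ω)/3 of a hexagon. It would send the dodecagon centre 0 to a dodecagon centre, which must be a
lattice vector, but the image (1 - ω)(1 + ω)/3 is not one. -/
theorem numFlagOrbits_motif_4_6_12 :
    (motif_4_6_12.toMotif.tess omega).numFlagOrbits = (6 : ℕ) := by
  refine motif_4_6_12.numFlagOrbits_eq covers_4_6_12 fun i i' h => ?_
  rcases separated_4_6_12 i i' h with h | ⟨rfl, rfl⟩
  · exact motif_4_6_12.not_equivalent_of_separated h
  rintro ⟨f, hf, a, b, t, hfab, hP, ht⟩
  obtain rfl : t = false := by simpa [table_4_6_12] using ht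
  have hc : f ((1 + omega) / 3) = (1 + omega) / 3 := congrArg center hP
  have hr := map_radius hfab (motif_4_6_12.labelled (table_4_6_12.repLabel 2))
  rw [hP] at hr
  have hq : (motif_4_6_12.tile 1).radius ≠ 0 := (motif_4_6_12.proper 1).2
  have ha : a = omega := by
    apply mul_right_cancel₀ hq
    simp only [SymmetricMotif.labelled, turn_radius, conjIf_false] at hr
    have h0 : (motif_4_6_12.tile 1).n = 6 := rfl
    change (motif_4_6_12.tile 1).radius * root (motif_4_6_12.tile 1).n ^ (1 : ℤ) =
      a * ((motif_4_6_12.tile 1).radius * root (motif_4_6_12.tile 1).n ^ (0 : ℤ)) at hr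
    rw [h0, root_six, zpow_one, zpow_zero, mul_one] at hr
    rw [← hr, mul_comm]
  obtain ⟨j, k, z, hz, h0⟩ := Motif.map_mem hf
    (Motif.tile_mem (D := motif_4_6_12.toMotif) (σ := omega) 0)
  have hn : 12 = (motif_4_6_12.tile j).n := congrArg RegularPolygon.n h0
  -- Tile 0 is the only dodecagon of the motif.
  have hj : j = 0 := by
    rw [motif_4_6_12.size_eq] at hn
    fin_cases j <;> simp [table_4_6_12] at hn ⊢
  subst hj
  have hb : f 0 = 0 + z := congrArg center h0
  rw [hfab] at hb hc
  apply one_sub_omega_mul_not_mem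
  convert hz using 1
  simp only [conjIf_false] at hb hc
  linear_combination hb - hc + (1 + omega) / 3 * ha

theorem numFlagOrbits_motif_3_3_4_3_4 :
    (motif_3_3_4_3_4.toMotif.tess Complex.I).numFlagOrbits = (5 : ℕ) := by
  refine motif_3_3_4_3_4.numFlagOrbits_eq covers_3_3_4_3_4 fun i i' h => ?_
  rcases separated_3_3_4_3_4 i i' h with h | ⟨rfl, rfl⟩
  · exact motif_3_3_4_3_4.not_equivalent_of_separated h
  rintro ⟨f, hf, a, b, t, hfab, hP, ht⟩
  -- A reflection of a square across its diagonal is not a symmetry.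
  obtain rfl : t = true := by simpa [table_3_3_4_3_4] using ht
  obtain ⟨k, rfl⟩ := motif_3_3_4_3_4.exists_eq_pow hf hfab
  have hr := map_radius hfab (motif_3_3_4_3_4.labelled (table_3_3_4_3_4.repLabel 0))
  rw [hP] at hr
  simp only [SymmetricMotif.labelled, turn_radius, conjIf_true] at hr
  change (tiles_3_3_4_3_4 0).radius * root (tiles_3_3_4_3_4 0).n ^ (0 : ℤ) =
    Complex.I ^ k * (starRingEnd ℂ)
      ((tiles_3_3_4_3_4 0).radius * root (tiles_3_3_4_3_4 0).n ^ (0 : ℤ)) at hr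
  -- Fourth powers eliminate the unknown iᵏ and would make the fourth power of the radius real, but
  -- the radius has argument π/6.
  have h4 : (Complex.I ^ k) ^ 4 = 1 := by
    rw [← pow_mul, mul_comm, pow_mul, Complex.I_pow_four, one_pow]
  rw [zpow_zero, mul_one] at hr
  have h5 := congrArg (· ^ 4) hr
  simp only [mul_pow, h4, one_mul] at h5
  have hs := sqrt_three_sq
  have hI := Complex.I_sq
  simp [tiles_3_3_4_3_4, radius, baseVertex, mk_eq, Complex.conj_ofReal, map_ofNat] at h5
  grind

/-! ### The theorem -/

/-- Both translation sets equal the lattice and both maps are governed by normalizers, so the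
equivalence follows by transferring linear parts in each direction. The equations `hτ` and `hτ'`
allow tessellations given by plain sets of tiles instead of indexed families. -/
theorem SymmetricMotif.compare {σ : ℂ} {m N M N' M' : ℕ} {T : FlagTable N M}
    {T' : FlagTable N' M'} (D : SymmetricMotif σ m T) (D' : SymmetricMotif σ m T') {n : ℕ}
    (hn : (D.toMotif.tess σ).numFlagOrbits = n) (hn' : (D'.toMotif.tess σ).numFlagOrbits = (1 : ℕ))
    {τ τ' : Tessellation} (hτ : D.toMotif.tess σ = τ) (hτ' : D'.toMotif.tess σ = τ') {u v : ℂ}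
    (hu : u ∈ τ.translations) (hv : v ∈ τ.translations) :
    (u ∈ τ'.translations ∧ v ∈ τ'.translations) ∧ τ.numFlagOrbits = n ∧
      (τ.IsAlmostRegularMap (Tessellation.transGroup u v) ↔
        τ'.IsRegularMap (Tessellation.transGroup u v)) := by
  subst hτ hτ'
  obtain ⟨Φ, hΦ⟩ := D.exists_rigid_flag
  obtain ⟨Φ', hΦ'⟩ := D'.exists_rigid_flag
  refine ⟨?_, hn, ?_⟩
  · rw [D'.translations_eq, ← D.translations_eq]
    exact ⟨hu, hv⟩
  · rw [Tessellation.isAlmostRegularMap_iff hn hΦ,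
      Tessellation.isRegularMap_iff (by exact_mod_cast hn') hΦ']
    exact ⟨Tessellation.aut_le_normalizer_of_linear_parts u v
        fun _ hf => D'.exists_trans_mul_mem D hf,
      Tessellation.aut_le_normalizer_of_linear_parts u v
        fun _ hf => D.exists_trans_mul_mem D' hf⟩

theorem Tessellation.periodic_congr {σ : ℂ} {S S' : Set RegularPolygon}
    (h : ∀ P, P ∈ S ↔ P ∈ S') : Tessellation.periodic σ S = Tessellation.periodic σ S' := by
  rw [Set.ext h]

theorem mainTheorem4 (t : ArchType) (o : ℂ) (ho : o ∈ t.tess.vertices) (u v : ℂ)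
    (hu : u ∈ t.tess.translations) (hv : v ∈ t.tess.translations)
    (huv : LinearIndependent ℝ ![u, v]) :
    (u ∈ (t.assoc o).translations ∧ v ∈ (t.assoc o).translations) ∧
      t.tess.numFlagOrbits = t.orbitNumber ∧
      (t.tess.IsAlmostRegularMap (Tessellation.transGroup u v) ↔
        (t.assoc o).IsRegularMap (Tessellation.transGroup u v)) := by
  have hsq : (motif_4_4_4_4 o).toMotif.tess Complex.I =
      Tessellation.periodic Complex.I {⟨4, o + (1 + Complex.I) / 2, o⟩} :=
    Tessellation.periodic_congr fun P => by
      simp [motif_4_4_4_4, tiles_4_4_4_4]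
  have htri : (motif_3_3_3_3_3_3 o).toMotif.tess omega = Tessellation.periodic omega
      {⟨3, o + (1 + omega) / 3, o⟩, ⟨3, o + 2 * (1 + omega) / 3, o + 1⟩} :=
    Tessellation.periodic_congr fun P => by
      simp [motif_3_3_3_3_3_3, tiles_3_3_3_3_3_3]
      tauto
  cases t
  · exact motif_4_8_8.compare (motif_4_4_4_4 o) numFlagOrbits_motif_4_8_8
      (numFlagOrbits_motif_4_4_4_4 o)
      (Tessellation.periodic_congr fun P => by
        simp [motif_4_8_8, tiles_4_8_8, tiles]
        tauto) hsq hu hv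
  · exact motif_3_6_3_6.compare (motif_3_3_3_3_3_3 o) numFlagOrbits_motif_3_6_3_6
      (numFlagOrbits_motif_3_3_3_3_3_3 o)
      (Tessellation.periodic_congr fun P => by
        simp [motif_3_6_3_6, tiles_3_6_3_6, tiles]
        tauto) htri hu hv
  · exact motif_3_12_12.compare (motif_3_3_3_3_3_3 o) numFlagOrbits_motif_3_12_12
      (numFlagOrbits_motif_3_3_3_3_3_3 o)
      (Tessellation.periodic_congr fun P => by
        simp [motif_3_12_12, tiles_3_12_12, tiles]
        tauto) htri hu hv
  · exact motif_4_6_12.compare (motif_3_3_3_3_3_3 o) numFlagOrbits_motif_4_6_12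
      (numFlagOrbits_motif_3_3_3_3_3_3 o)
      (Tessellation.periodic_congr fun P => by
        simp [motif_4_6_12, tiles_4_6_12, tiles]
        tauto) htri hu hv
  · exact motif_3_4_6_4.compare (motif_3_3_3_3_3_3 o) numFlagOrbits_motif_3_4_6_4
      (numFlagOrbits_motif_3_3_3_3_3_3 o)
      (Tessellation.periodic_congr fun P => by
        simp [motif_3_4_6_4, tiles_3_4_6_4, tiles]
        tauto) htri hu hv
  · exact motif_3_3_4_3_4.compare (motif_4_4_4_4 o) numFlagOrbits_motif_3_3_4_3_4
      (numFlagOrbits_motif_4_4_4_4 o)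
      (Tessellation.periodic_congr fun P => by
        simp [motif_3_3_4_3_4, tiles_3_3_4_3_4, tiles]
        tauto) hsq hu hv

end
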